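/- Let $n\ge 2$ and let $X=(X_1,\ldots,X_n)$ be an $n$-dimensional Lévy process such that **(D)** $X_k(t)\to-\infty$ almost surely as $t\to\infty$, for every $k=1,\ldots,n$; **(H)** $X_j(t)=\Pi(t)-c_jt$ for $j=1,\ldots,n$ and $t\ge0$, where $\Pi$ is a compound Poisson process with positive jumps only and jump intensity $\lambda\in(0,\infty)$, and $c_1>c_2>\cdots>c_n$. For each $k$ put $\underline X_k(t)=\inf_{0\le s\le t}X_k(s)$, $\underline R_k^{(0)}=0$ and, for $i\ge1$, $$\underline S_k^{(i)}=\inf\{t>\underline R_k^{(i-1)}:\underline X_k(t)\ne X_k(t)\},\qquad \underline R_k^{(i)}=\inf\{t>\underline S_k^{(i)}:\underline X_k(t)=X_k(t)\},$$ so that $[\underline S_k^{(i)},\underline R_k^{(i)})$ is the $i$-th excursion interval of $X_k-\underline X_k$ away from $0$. For $1\le j\le k\le n$ let $$\rho_j^{(k)}=\sup\{\underline R_j^{(i)}:i\ge1,\ \underline R_j^{(i)}\le\underline R_k^{(1)}\},\qquad \sigma_j^{(k)}=\sup\{\underline S_j^{(i)}:i\ge1,\ \underline S_j^{(i)}\le\underline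 R_k^{(1)}\}.$$ For $2\le k\le n$, $1\le j\le k$ and $\beta=(\beta_1,\ldots,\beta_{k-1})\in\mathbb R_+^{k-1}$ set $$\mathcal C_j^k(\beta)=c_j\sum_{\ell=j}^{k-1}\left(\frac1{c_{\ell+1}}-\frac1{c_\ell}\right)(\lambda+\beta_\ell),$$ so that $\mathcal C_k^k(\beta)=0$. Then for every $k=2,\ldots,n$, $\beta\in\mathbb R_+^{k-1}$ and $\gamma\ge0$, all the expectations below are finite, and $$\mathbb E\, e^{-\sum_{j=1}^{k-1}\beta_j\left(\rho_{j+1}^{(k)}-\rho_j^{(k)}\right)-\gamma\left(\rho_k^{(k)}-\sigma_k^{(k)}\right)} =\left(\prod_{j=1}^{k-1}\frac{\beta_j+\lambda\,\mathbb E\, e^{-\left[\mathcal C_{j+1}^k(\beta)+\frac{c_{j+1}}{c_k}\gamma\right]\left(\rho_{j+1}^{(j+1)}-\sigma_{j+1}^{(j+1)}\right)}}{\beta_j+\lambda\,\mathbb E\, e^{-\left[\mathcal C_j^k(\beta)+\frac{c_j}{c_k}\gamma\right]\left(\rho_j^{(j)}-\sigma_j^{(j)}\right)}}\right) \mathbb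 E\, e^{-\left[\mathcal C_1^k(\beta)+\frac{c_1}{c_k}\gamma\right]\left(\rho_1^{(1)}-\sigma_1^{(1)}\right)}.$$ -/

import Mathlib

open MeasureTheory ProbabilityTheory Filter

noncomputable section

namespace LevyExcursion

/-! ### Excursions of a path above its running infimum

Paths are functions `x : ℝ → ℝ`, of which only the values at times `t ≥ 0` are used. -/

/-- The running infimum `inf_{0 ≤ s ≤ t} x(s)`. -/
def runInf (x : ℝ → ℝ) (t : ℝ) : ℝ := sInf (x '' Set.Icc 0 t)

/-- The first time after `r` at which the path differs from its running infimum. -/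
def nextStart (x : ℝ → ℝ) (r : ℝ) : ℝ := sInf {t : ℝ | r < t ∧ runInf x t ≠ x t}

/-- The first time after `s` at which the path agrees with its running infimum. -/
def nextEnd (x : ℝ → ℝ) (s : ℝ) : ℝ := sInf {t : ℝ | s < t ∧ runInf x t = x t}

/-- The end `R^(j)` of the `j`-th excursion of the path above its running infimum, with
`R^(0) = 0`. -/
def excEnd (x : ℝ → ℝ) : ℕ → ℝ
  | 0 => 0
  | j + 1 => nextEnd x (nextStart x (excEnd x j))

/-- The beginning `S^(j)` of the `j`-th excursion, `j ≥ 1`: the first time after `R^(j-1)` at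
which the path differs from its running infimum. -/
def excStart (x : ℝ → ℝ) (j : ℕ) : ℝ := nextStart x (excEnd x (j - 1))

/-- `ρ^(k)_j` at the sample point `ω`: the last end of an excursion of `X_j` above its running
infimum which is not later than the end of the first such excursion of `X_k`. -/
def rho {Ω : Type*} (X : ℕ → ℝ → Ω → ℝ) (k j : ℕ) (ω : Ω) : ℝ :=
  sSup {r : ℝ | ∃ i : ℕ, 1 ≤ i ∧ r = excEnd (fun t => X j t ω) i ∧
    r ≤ excEnd (fun t => X k t ω) 1}

/-- `σ^(k)_j` at the sample point `ω`: the last beginning of an excursion of `X_j` above its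
running infimum which is not later than the end of the first such excursion of `X_k`. -/
def sigma {Ω : Type*} (X : ℕ → ℝ → Ω → ℝ) (k j : ℕ) (ω : Ω) : ℝ :=
  sSup {s : ℝ | ∃ i : ℕ, 1 ≤ i ∧ s = excStart (fun t => X j t ω) i ∧
    s ≤ excEnd (fun t => X k t ω) 1}

/-! ### The probabilistic assumptions -/

/-- `Pi` is, under `P`, a compound Poisson process with jump intensity `lam ∈ (0, ∞)` and positive
jumps: there are i.i.d. exponential interarrival times `τ 0, τ 1, …` with rate `lam` and,
independent of them, i.i.d. positive jump sizes `U 0, U 1, …` such that almost surely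
`Pi t = U 0 + … + U (m - 1)` whenever exactly `m` jump epochs `τ 0 + … + τ i` are `≤ t`. -/
structure IsPosCompoundPoisson {Ω : Type*} [MeasurableSpace Ω] (P : Measure Ω) (lam : ℝ)
    (Pi : ℝ → Ω → ℝ) : Prop where
  rate_pos : 0 < lam
  exists_repr : ∃ τ U : ℕ → Ω → ℝ,
    (∀ i, HasLaw (τ i) (expMeasure lam) P) ∧
    (∀ i, IdentDistrib (U i) (U 0) P P) ∧
    (∀ i, ∀ᵐ ω ∂P, 0 < U i ω) ∧
    iIndepFun (Sum.elim τ U) P ∧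
    ∀ᵐ ω ∂P, ∀ m : ℕ, ∀ t : ℝ,
      ∑ i ∈ Finset.range m, τ i ω ≤ t → t < ∑ i ∈ Finset.range (m + 1), τ i ω →
        Pi t ω = ∑ i ∈ Finset.range m, U i ω

/-- Assumption D: all the components `X_1, …, X_n` drift to `-∞` almost surely. -/
def AssumptionD {Ω : Type*} [MeasurableSpace Ω] (P : Measure Ω) (n : ℕ)
    (X : ℕ → ℝ → Ω → ℝ) : Prop :=
  ∀ j ∈ Set.Icc 1 n, ∀ᵐ ω ∂P, Tendsto (fun t => X j t ω) atTop atBot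

/-- Assumption H: `X_j(t) = Π(t) - c_j t` for `j = 1, …, n`, where `Π` is a compound Poisson
process with positive jumps and intensity `lam`, and `c_j` decreases strictly in `j`. -/
structure AssumptionH {Ω : Type*} [MeasurableSpace Ω] (P : Measure Ω) (n : ℕ) (lam : ℝ)
    (c : ℕ → ℝ) (X : ℕ → ℝ → Ω → ℝ) : Prop where
  strictAntiOn : StrictAntiOn c (Set.Icc 1 n)
  exists_driver : ∃ Pi : ℝ → Ω → ℝ, IsPosCompoundPoisson P lam Pi ∧
    ∀ j ∈ Set.Icc 1 n, ∀ᵐ ω ∂P, ∀ t : ℝ, 0 ≤ t → X j t ω = Pi t ω - c j * t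

/-- `𝒞_j^k(β) = c_j ∑_{ℓ=j}^{k-1} (1 / c_{ℓ+1} - 1 / c_ℓ) (λ + β_ℓ)`. -/
def shiftC (c : ℕ → ℝ) (lam : ℝ) (β : ℕ → ℝ) (k j : ℕ) : ℝ :=
  c j * ∑ l ∈ Finset.Ico j k, (1 / c (l + 1) - 1 / c l) * (lam + β l)

/-- `E exp(-θ (ρ^(j)_j - σ^(j)_j))`, the transform of the length of the first excursion of
`X_j` above its running infimum. -/
def excTransform {Ω : Type*} [MeasurableSpace Ω] (P : Measure Ω) (X : ℕ → ℝ → Ω → ℝ)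
    (j : ℕ) (θ : ℝ) : ℝ :=
  ∫ ω, Real.exp (-θ * (rho X j j ω - sigma X j j ω)) ∂P

end LevyExcursion

end

open LevyExcursion

open LevyExcursion

/-! Let the jumps of `Π` feed queues with service rates `c j`. Then `X_j` minus its running infimum
is the workload of queue `j`. All queues receive the same jumps, so a larger rate gives a smaller
workload, which empties sooner. The first excursion of `X_k` ends when queue `k` empties, and
`ρ_j^(k)` is the time at which queue `j` empties after the last jump of that excursion
(`exists_rho_sigma_eq`).

The expectation is found from a value function: the mean discounted reward when the workloads just
after a jump are `y`. An explicit candidate is `expMix` with `φ = 1`, built by adding one slower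
queue at a time. In it `exp (-η j * y)` is the transform at `θ j` of the emptying time of queue `j`
from `y`, which requires `c j * η j = θ j + lam * (1 - φ j)` with `φ j` the transform of a jump at
`η j`. The discounts start from `γ` at the slowest queue and follow `θ j = 𝒞_j^k(β) + c_j γ / c_k`;
this is what makes the coupling factor `exp (-μ k * (y (k + 1) - y k))` turn discounting at `θ (k +
1)` into discounting at `θ k`. The candidate solves the first-jump equation
(`expMix_eq_add_integral_firstJump`).

Hence the reward paid so far plus the discounted value is a bounded process of constant mean that
converges to the reward (`integral_excursionReward`). The expectation is therefore the mean value
after a jump into empty queues, `expMix μ η A φ k 0`, which collapses to the product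
(`expMix_zero_eq_prod`). The same result for a single queue identifies `φ j` with the transform of
the first excursion of `X_j` at `θ j`. -/

/-! ### The value function and its first-jump equation -/

/-- A nested mixture of exponentials of a vector of workloads. With `φ = 1` it is the value
function of the functional of the excursion; with `φ j` the Laplace transform of the jump size at
`η j` it is the mean of that value function after a jump. -/
noncomputable def expMix (μ η A φ : ℕ → ℝ) : ℕ → (ℕ → ℝ) → ℝ
  | 0, y => φ 0 * Real.exp (-η 0 * y 0)
  | k + 1, y =>
      Real.exp (-μ k * (y (k + 1) - y k)) *
        (expMix μ η A φ k y - A k * (φ k * Real.exp (-η k * y k))) +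
      A k * (φ (k + 1) * Real.exp (-η (k + 1) * y (k + 1)))

theorem le_of_forall_le_succ {f : ℕ → ℝ} {j k : ℕ} (h : ∀ i < k, f i ≤ f (i + 1)) (hj : j ≤ k) :
    f j ≤ f k := by
  induction k, hj using Nat.le_induction with
  | base => exact le_rfl
  | succ i _ ih => exact (ih fun i' hi' => h i' (by omega)).trans (h i (by omega))

theorem expMix_congr (μ η A φ : ℕ → ℝ) (k : ℕ) {y z : ℕ → ℝ} (h : ∀ j ≤ k, y j = z j) :
    expMix μ η A φ k y = expMix μ η A φ k z := by
  induction k with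
  | zero => simp [expMix, h 0 le_rfl]
  | succ k ih =>
    simp only [expMix, ih fun j hj => h j (by omega), h k (by omega), h (k + 1) le_rfl]

theorem continuous_expMix (μ η A φ : ℕ → ℝ) (k : ℕ) : Continuous fun y => expMix μ η A φ k y := by
  induction k with
  | zero => simp only [expMix]; fun_prop
  | succ k ih => simp only [expMix]; fun_prop

/-- The bound needs nonnegative workloads in increasing order, since only then is every exponent
nonpositive. It supplies the domination for the limit in `integral_excursionReward`. -/
theorem exists_abs_expMix_le (μ η A φ : ℕ → ℝ) (hφ : ∀ j, |φ j| ≤ 1) (k : ℕ)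
    (hμ : ∀ j < k, 0 ≤ μ j) (hη : ∀ j ≤ k, 0 ≤ η j) :
    ∃ C : ℝ, ∀ y : ℕ → ℝ, (∀ j ≤ k, 0 ≤ y j) → (∀ j < k, y j ≤ y (j + 1)) →
      |expMix μ η A φ k y| ≤ C := by
  have key : ∀ j (x : ℝ), j ≤ k → 0 ≤ x → |φ j * Real.exp (-η j * x)| ≤ 1 := by
    intro j x hj hx
    rw [abs_mul, Real.abs_exp]
    refine mul_le_one₀ (hφ j) (Real.exp_nonneg _) (Real.exp_le_one_iff.2 ?_)
    have := mul_nonneg (hη j hj) hx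
    linarith
  induction k with
  | zero => exact ⟨1, fun y hy _ => by simpa only [expMix] using key 0 (y 0) le_rfl (hy 0 le_rfl)⟩
  | succ k ih =>
    obtain ⟨C, hC⟩ := ih (fun j hj => hμ j (by omega)) (fun j hj => hη j (by omega))
      (fun j x hj => key j x (by omega))
    refine ⟨C + |A k| + |A k|, fun y hy hm => ?_⟩
    have h1 := hC y (fun j hj => hy j (by omega)) (fun j hj => hm j (by omega))
    have h2 := key k (y k) (by omega) (hy k (by omega))
    have h3 := key (k + 1) (y (k + 1)) le_rfl (hy _ le_rfl)
    have h4 : Real.exp (-μ k * (y (k + 1) - y k)) ≤ 1 := by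
      have := mul_nonneg (hμ k (by omega)) (sub_nonneg.2 (hm k (by omega)))
      exact Real.exp_le_one_iff.2 (by linarith)
    have h5 : ∀ x : ℝ, |x| ≤ 1 → |A k * x| ≤ |A k| := fun x hx => by
      rw [abs_mul]; exact mul_le_of_le_one_right (abs_nonneg _) hx
    unfold expMix
    refine (abs_add_le _ _).trans (add_le_add ?_ (h5 _ h3))
    rw [abs_mul, Real.abs_exp]
    refine (mul_le_of_le_one_left (abs_nonneg _) h4).trans ?_
    exact (abs_sub _ _).trans (add_le_add h1 (h5 _ h2))

/-- Averaging over a common shift of all the workloads. -/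
theorem integral_expMix_add (μ η A φ : ℕ → ℝ) (ν : Measure ℝ) (k : ℕ)
    (hint : ∀ j ≤ k, Integrable (fun u => Real.exp (-η j * u)) ν)
    (hφ : ∀ j ≤ k, ∫ u, Real.exp (-η j * u) ∂ν = φ j) (z : ℕ → ℝ) :
    Integrable (fun u => expMix μ η A 1 k fun j => z j + u) ν ∧
      ∫ u, expMix μ η A 1 k (fun j => z j + u) ∂ν = expMix μ η A φ k z := by
  have e : ∀ j (u : ℝ), Real.exp (-η j * (z j + u)) =
      Real.exp (-η j * z j) * Real.exp (-η j * u) := fun j u => by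
    rw [← Real.exp_add]; ring_nf
  have hI : ∀ j ≤ k, Integrable (fun u => Real.exp (-η j * (z j + u))) ν := fun j hj => by
    simp only [e]; exact (hint j hj).const_mul _
  have hV : ∀ j ≤ k, ∫ u, Real.exp (-η j * (z j + u)) ∂ν = φ j * Real.exp (-η j * z j) :=
    fun j hj => by simp only [e]; rw [integral_const_mul, hφ j hj, mul_comm]
  induction k with
  | zero =>
    simp only [expMix, Pi.one_apply, one_mul]
    exact ⟨hI 0 le_rfl, hV 0 le_rfl⟩
  | succ k ih =>
    obtain ⟨h1, h2⟩ := ih (fun j hj => hint j (by omega)) (fun j hj => hφ j (by omega))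
      (fun j hj => hI j (by omega)) (fun j hj => hV j (by omega))
    -- The shift cancels in the differences of workloads, so the coupling factor does not depend on
    -- `u`.
    simp only [expMix, Pi.one_apply, one_mul, add_sub_add_right_eq_sub]
    have h3 := hI k (by omega)
    have h4 := hI (k + 1) le_rfl
    refine ⟨((h1.sub (h3.const_mul _)).const_mul _).add (h4.const_mul _), ?_⟩
    rw [integral_add (f := fun u => Real.exp (-μ k * (z (k + 1) - z k)) *
        ((expMix μ η A 1 k fun j => z j + u) - A k * Real.exp (-η k * (z k + u))))
        ((h1.sub (h3.const_mul _)).const_mul _) (h4.const_mul _),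
      integral_const_mul, integral_sub h1 (h3.const_mul _), integral_const_mul,
      integral_const_mul, h2, hV k (by omega), hV (k + 1) le_rfl]

theorem integral_mul_exp_mul (κ a b : ℝ) :
    ∫ t in a..b, κ * Real.exp (κ * t) = Real.exp (κ * b) - Real.exp (κ * a) := by
  refine intervalIntegral.integral_eq_sub_of_hasDerivAt (f := fun t => Real.exp (κ * t))
    (fun t _ => ?_) (by apply Continuous.intervalIntegrable; fun_prop)
  have := ((hasDerivAt_id t).const_mul κ).exp
  simpa [mul_comm] using this

/-- First-jump decomposition for the transform of a first passage time. -/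
theorem exp_eq_add_integral_firstJump {lam c θ η φ y : ℝ} (hc : 0 < c)
    (hη : c * η = θ + lam * (1 - φ)) (hy : 0 ≤ y) :
    Real.exp (-η * y) = Real.exp (-(lam + θ) * (y / c)) +
      ∫ t in (0)..(y / c), lam * Real.exp (-(lam + θ) * t) *
        (φ * Real.exp (-η * max (y - c * t) 0)) := by
  have h1 : ∀ t ∈ Set.uIcc 0 (y / c), lam * Real.exp (-(lam + θ) * t) *
      (φ * Real.exp (-η * max (y - c * t) 0)) =
      -- By `hη` the exponents combine to `lam + θ - c * η = lam * φ`, so the integrand is an exact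
      -- derivative.
      -Real.exp (-η * y) * ((-(lam * φ)) * Real.exp (-(lam * φ) * t)) := by
    intro t ht
    rw [Set.uIcc_of_le (by positivity)] at ht
    have : c * t ≤ y := by rw [mul_comm]; exact (le_div_iff₀ hc).1 ht.2
    rw [max_eq_left (by linarith)]
    have e : Real.exp (-(lam + θ) * t) * Real.exp (-η * (y - c * t)) =
        Real.exp (-η * y) * Real.exp (-(lam * φ) * t) := by
      rw [← Real.exp_add, ← Real.exp_add]
      congr 1
      linear_combination t * hη
    linear_combination lam * φ * e
  rw [intervalIntegral.integral_congr h1, intervalIntegral.integral_const_mul,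
    integral_mul_exp_mul]
  have e : Real.exp (-(lam + θ) * (y / c)) =
      Real.exp (-η * y) * Real.exp (-(lam * φ) * (y / c)) := by
    rw [← Real.exp_add]
    congr 1
    field_simp
    linear_combination y * hη
  rw [e]
  simp
  ring

/-- First-jump decomposition of the value function: `y j / c j` is the time at which the `j`-th
workload empties if no further jump occurs. -/
theorem expMix_eq_add_integral_firstJump {lam : ℝ} {c β θ μ η A φ : ℕ → ℝ} (k : ℕ)
    (hc : ∀ j ≤ k, 0 < c j)
    (hη : ∀ j ≤ k, c j * η j = θ j + lam * (1 - φ j))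
    (hθ : ∀ j < k, θ j = θ (j + 1) + μ j * (c j - c (j + 1)))
    (hμ : ∀ j < k, μ j * c (j + 1) = lam + θ (j + 1) + β j)
    (hA : ∀ j < k, A j * (β j + lam * φ j) = lam * expMix μ η A φ j 0)
    (y : ℕ → ℝ) (hy : ∀ j ≤ k, 0 ≤ y j) (hm : ∀ j < k, y j / c j ≤ y (j + 1) / c (j + 1)) :
    expMix μ η A 1 k y = Real.exp (-(lam + θ k) * (y k / c k)) *
        Real.exp (-∑ i ∈ Finset.range k, β i * (y (i + 1) / c (i + 1) - y i / c i)) +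
      ∫ t in (0)..(y k / c k), lam * Real.exp (-(lam + θ k) * t) *
        expMix μ η A φ k fun j => max (y j - c j * t) 0 := by
  induction k with
  | zero =>
    simp only [expMix, Pi.one_apply, one_mul, Finset.range_zero, Finset.sum_empty, neg_zero,
      Real.exp_zero, mul_one]
    exact exp_eq_add_integral_firstJump (hc 0 le_rfl) (hη 0 le_rfl) (hy 0 le_rfl)
  | succ k ih =>
    have ih := ih (fun j hj => hc j (by omega)) (fun j hj => hη j (by omega))
      (fun j hj => hθ j (by omega)) (fun j hj => hμ j (by omega)) (fun j hj => hA j (by omega))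
      (fun j hj => hy j (by omega)) (fun j hj => hm j (by omega))
    have b0 := exp_eq_add_integral_firstJump (hc k (by omega)) (hη k (by omega))
      (hy k (by omega))
    have b1 := exp_eq_add_integral_firstJump (hc (k + 1) le_rfl) (hη (k + 1) le_rfl)
      (hy (k + 1) le_rfl)
    have hθk := hθ k (by omega)
    have hμk := hμ k (by omega)
    have hAk := hA k (by omega)
    have hck := hc k (by omega)
    have hck1 := hc (k + 1) le_rfl
    have hmk := hm k (by omega)
    have ht0 : 0 ≤ y k / c k := div_nonneg (hy k (by omega)) hck.le
    have ht1 : 0 ≤ y (k + 1) / c (k + 1) := div_nonneg (hy (k + 1) (by omega)) hck1.le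
    have hle : ∀ j ≤ k, y j / c j ≤ y k / c k := fun j hj =>
      le_of_forall_le_succ (f := fun j => y j / c j) (fun j hj => hm j (by omega)) hj
    have ey0 : y k = c k * (y k / c k) := by field_simp
    have ey1 : y (k + 1) = c (k + 1) * (y (k + 1) / c (k + 1)) := by field_simp
    set t₀ := y k / c k with ht₀
    set t₁ := y (k + 1) / c (k + 1) with ht₁
    set f : ℝ → ℝ := fun t => lam * Real.exp (-(lam + θ k) * t) *
        expMix μ η A φ k fun j => max (y j - c j * t) 0 with hf
    set g₀ : ℝ → ℝ := fun t => lam * Real.exp (-(lam + θ k) * t) *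
        (φ k * Real.exp (-η k * max (y k - c k * t) 0)) with hg₀
    set g₁ : ℝ → ℝ := fun t => lam * Real.exp (-(lam + θ (k + 1)) * t) *
        (φ (k + 1) * Real.exp (-η (k + 1) * max (y (k + 1) - c (k + 1) * t) 0)) with hg₁
    have cmix : ∀ k, Continuous fun t : ℝ => expMix μ η A φ k fun j => max (y j - c j * t) 0 :=
      fun k => (continuous_expMix μ η A φ k).comp (by fun_prop)
    have cf : Continuous f := by have := cmix k; fun_prop
    have cg₀ : Continuous g₀ := by fun_prop
    have cg₁ : Continuous g₁ := by fun_prop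
    set E := Real.exp (-μ k * (y (k + 1) - y k)) with hE
    -- Until queue `k` empties, the gap between the last two workloads grows at rate `c k - c (k +
    -- 1)`; by `hθ` this growth replaces `θ (k + 1)` by `θ k`, and the factor `E` of time 0 comes
    -- out.
    have first : ∀ t ∈ Set.uIcc 0 t₀, lam * Real.exp (-(lam + θ (k + 1)) * t) *
        expMix μ η A φ (k + 1) (fun j => max (y j - c j * t) 0) =
        E * (f t - A k * g₀ t) + A k * g₁ t := by
      intro t ht
      rw [Set.uIcc_of_le ht0] at ht
      have h1 : max (y k - c k * t) 0 = y k - c k * t := by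
        refine max_eq_left ?_
        rw [ey0, ← mul_sub]
        exact mul_nonneg hck.le (by linarith [ht.2])
      have h2 : max (y (k + 1) - c (k + 1) * t) 0 = y (k + 1) - c (k + 1) * t := by
        refine max_eq_left ?_
        rw [ey1, ← mul_sub]
        exact mul_nonneg hck1.le (by linarith [ht.2])
      have e : Real.exp (-(lam + θ (k + 1)) * t) * Real.exp (-μ k *
          (max (y (k + 1) - c (k + 1) * t) 0 - max (y k - c k * t) 0)) =
          E * Real.exp (-(lam + θ k) * t) := by
        rw [h1, h2, hE, ← Real.exp_add, ← Real.exp_add]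
        congr 1
        linear_combination t * hθk
      simp only [expMix, hf, hg₀, hg₁]
      linear_combination lam * (expMix μ η A φ k (fun j => max (y j - c j * t) 0) -
        A k * (φ k * Real.exp (-η k * max (y k - c k * t) 0))) * e
    -- Between `t₀` and `t₁` only queue `k + 1` still holds work, so the inner mixture is frozen at
    -- 0; `hA` turns `lam * (expMix μ η A φ k 0 - A k * φ k)` into `A k * β k`.
    have second : ∀ t ∈ Set.uIcc t₀ t₁, lam * Real.exp (-(lam + θ (k + 1)) * t) *
        expMix μ η A φ (k + 1) (fun j => max (y j - c j * t) 0) =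
        A k * Real.exp (-(lam + θ (k + 1) + β k) * t₁) * (β k * Real.exp (β k * t))
          + A k * g₁ t := by
      intro t ht
      rw [Set.uIcc_of_le hmk] at ht
      have h1 : ∀ j ≤ k, max (y j - c j * t) 0 = 0 := by
        intro j hj
        refine max_eq_right ?_
        have := (div_le_iff₀ (hc j (by omega))).1 ((hle j hj).trans ht.1)
        linarith
      have h2 : max (y (k + 1) - c (k + 1) * t) 0 = y (k + 1) - c (k + 1) * t := by
        refine max_eq_left ?_
        rw [ey1, ← mul_sub]
        exact mul_nonneg hck1.le (by linarith [ht.2])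
      have e : Real.exp (-(lam + θ (k + 1)) * t) * Real.exp (-μ k *
          (max (y (k + 1) - c (k + 1) * t) 0 - max (y k - c k * t) 0)) =
          Real.exp (-(lam + θ (k + 1) + β k) * t₁) * Real.exp (β k * t) := by
        rw [h1 k le_rfl, h2, ← Real.exp_add, ← Real.exp_add]
        congr 1
        linear_combination (t - t₁) * hμk - μ k * ey1
      simp only [expMix, hg₁]
      rw [expMix_congr μ η A φ k (z := 0) (fun j hj => h1 j hj)]
      rw [show Real.exp (-η k * max (y k - c k * t) 0) = 1 by rw [h1 k le_rfl]; simp]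
      linear_combination lam * (expMix μ η A φ k 0 - A k * φ k) * e -
        Real.exp (-(lam + θ (k + 1) + β k) * t₁) * Real.exp (β k * t) * hAk
    have ii : ∀ {h : ℝ → ℝ} (a b : ℝ), Continuous h → IntervalIntegrable h volume a b :=
      fun a b h => h.intervalIntegrable a b
    rw [← intervalIntegral.integral_add_adjacent_intervals (b := t₀)
        (ii _ _ (by have := cmix (k + 1); fun_prop)) (ii _ _ (by have := cmix (k + 1); fun_prop)),
      intervalIntegral.integral_congr first, intervalIntegral.integral_congr second,
      intervalIntegral.integral_add (ii _ _ (by fun_prop)) (ii _ _ (by fun_prop)),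
      intervalIntegral.integral_add (ii _ _ (by fun_prop)) (ii _ _ (by fun_prop)),
      intervalIntegral.integral_const_mul, intervalIntegral.integral_const_mul,
      intervalIntegral.integral_const_mul, integral_mul_exp_mul,
      intervalIntegral.integral_const_mul,
      intervalIntegral.integral_sub (ii _ _ (by fun_prop)) (ii _ _ (by fun_prop)),
      intervalIntegral.integral_const_mul]
    have split := intervalIntegral.integral_add_adjacent_intervals
      (ii 0 t₀ cg₁) (ii t₀ t₁ cg₁)
    have hsum : Real.exp (-∑ i ∈ Finset.range (k + 1),
          β i * (y (i + 1) / c (i + 1) - y i / c i)) =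
        Real.exp (-∑ i ∈ Finset.range k, β i * (y (i + 1) / c (i + 1) - y i / c i)) *
          Real.exp (-(β k * (t₁ - t₀))) := by
      rw [Finset.sum_range_succ, ← Real.exp_add, ← neg_add]
    rw [hsum]
    simp only [expMix, Pi.one_apply, one_mul]
    rw [← hE]
    set T := Real.exp (-∑ i ∈ Finset.range k, β i * (y (i + 1) / c (i + 1) - y i / c i))
    -- At `t₀` the coupling factor yields both the discount up to `t₁` and the new reward factor for
    -- the gap `t₁ - t₀`; the boundary terms `e2` and `e3` of `second` cancel the corrections with
    -- `A k`.
    have e1 : E * Real.exp (-(lam + θ k) * t₀) =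
        Real.exp (-(lam + θ (k + 1)) * t₁) * Real.exp (-(β k * (t₁ - t₀))) := by
      rw [hE, ← Real.exp_add, ← Real.exp_add]
      congr 1
      linear_combination (t₀ - t₁) * hμk - μ k * ey1 + μ k * ey0 - t₀ * hθk
    have e2 : Real.exp (-(lam + θ (k + 1) + β k) * t₁) * Real.exp (β k * t₁) =
        Real.exp (-(lam + θ (k + 1)) * t₁) := by
      rw [← Real.exp_add]; ring_nf
    have e3 : Real.exp (-(lam + θ (k + 1) + β k) * t₁) * Real.exp (β k * t₀) =
        Real.exp (-(lam + θ (k + 1)) * t₁) * Real.exp (-(β k * (t₁ - t₀))) := by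
      rw [← Real.exp_add, ← Real.exp_add]; ring_nf
    linear_combination E * ih - E * A k * b0 + A k * b1 - A k * split + (T - A k) * e1
      - A k * e2 + A k * e3

/-! ### Workloads and the excursions of a path -/

/-- The epoch of the `m`-th jump, for interarrival times `τ`; `epoch τ 0 = 0`. -/
def epoch (τ : ℕ → ℝ) (m : ℕ) : ℝ := ∑ i ∈ Finset.range m, τ i

/-- The workload just after the `m`-th jump of a queue that is served at rate `c`. -/
noncomputable def workload (c : ℝ) (τ U : ℕ → ℝ) : ℕ → ℝ
  | 0 => 0
  | m + 1 => max (workload c τ U m - c * τ m) 0 + U m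

/-- The time at which the workload found just after the `m`-th jump is served. -/
noncomputable def emptyingTime (c : ℝ) (τ U : ℕ → ℝ) (m : ℕ) : ℝ :=
  epoch τ m + workload c τ U m / c

theorem epoch_succ (τ : ℕ → ℝ) (m : ℕ) : epoch τ (m + 1) = epoch τ m + τ m :=
  Finset.sum_range_succ _ _

theorem epoch_strictMono {τ : ℕ → ℝ} (hτ : ∀ i, 0 < τ i) : StrictMono (epoch τ) :=
  strictMono_nat_of_lt_succ fun m => by rw [epoch_succ]; linarith [hτ m]

theorem epoch_nonneg {τ : ℕ → ℝ} (hτ : ∀ i, 0 < τ i) (m : ℕ) : 0 ≤ epoch τ m :=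
  Finset.sum_nonneg fun i _ => (hτ i).le

theorem exists_epoch_le_lt {τ : ℕ → ℝ} (h : Tendsto (epoch τ) atTop atTop) {t : ℝ} (ht : 0 ≤ t) :
    ∃ m, epoch τ m ≤ t ∧ t < epoch τ (m + 1) := by
  classical
  have hex : ∃ m, t < epoch τ m := (h.eventually_gt_atTop t).exists
  have h0 : Nat.find hex ≠ 0 := fun h0 => by
    have := Nat.find_spec hex
    rw [h0] at this
    simp only [epoch, Finset.range_zero, Finset.sum_empty] at this
    linarith
  obtain ⟨m, hm⟩ := Nat.exists_eq_succ_of_ne_zero h0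
  refine ⟨m, not_lt.1 (Nat.find_min hex (by omega)), ?_⟩
  have := Nat.find_spec hex
  rwa [hm] at this

theorem workload_succ_pos {c : ℝ} {τ U : ℕ → ℝ} (hU : ∀ i, 0 < U i) (m : ℕ) :
    0 < workload c τ U (m + 1) :=
  add_pos_of_nonneg_of_pos (le_max_right _ _) (hU m)

theorem workload_nonneg {c : ℝ} {τ U : ℕ → ℝ} (hU : ∀ i, 0 < U i) (m : ℕ) :
    0 ≤ workload c τ U m := by
  cases m with
  | zero => exact le_rfl
  | succ m => exact (workload_succ_pos hU m).le

theorem workload_anti {c c' : ℝ} {τ U : ℕ → ℝ} (hτ : ∀ i, 0 < τ i) (h : c ≤ c') (m : ℕ) :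
    workload c' τ U m ≤ workload c τ U m := by
  induction m with
  | zero => exact le_rfl
  | succ m ih =>
    have := mul_le_mul_of_nonneg_right h (hτ m).le
    simp only [workload]
    gcongr

/-- This is the order of emptying: faster queues have less work and serve it faster. -/
theorem workload_div_anti {c c' : ℝ} {τ U : ℕ → ℝ} (hc : 0 < c) (hτ : ∀ i, 0 < τ i)
    (hU : ∀ i, 0 < U i) (h : c ≤ c') (m : ℕ) :
    workload c' τ U m / c' ≤ workload c τ U m / c :=
  div_le_div₀ (workload_nonneg hU m) (workload_anti hτ h m) hc h

section Path

variable {c : ℝ} {τ U : ℕ → ℝ} {x : ℝ → ℝ}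

theorem path_sub (hx : ∀ m t, epoch τ m ≤ t → t < epoch τ (m + 1) →
      x t = ∑ i ∈ Finset.range m, U i - c * t) (hτ : ∀ i, 0 < τ i)
    {m : ℕ} {t : ℝ} (h1 : epoch τ m ≤ t) (h2 : t < epoch τ (m + 1)) :
    x t = x (epoch τ m) - c * (t - epoch τ m) := by
  rw [hx m t h1 h2, hx m _ le_rfl (epoch_strictMono hτ m.lt_succ_self)]
  ring

theorem path_epoch_succ (hx : ∀ m t, epoch τ m ≤ t → t < epoch τ (m + 1) →
      x t = ∑ i ∈ Finset.range m, U i - c * t) (hτ : ∀ i, 0 < τ i) (m : ℕ) :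
    x (epoch τ (m + 1)) = x (epoch τ m) - c * τ m + U m := by
  rw [hx m _ le_rfl (epoch_strictMono hτ m.lt_succ_self),
    hx (m + 1) _ le_rfl (epoch_strictMono hτ (m + 1).lt_succ_self), Finset.sum_range_succ,
    epoch_succ]
  ring

/-- The path decreases between jumps, so the new infimum is the minimum of the old one and the
current value. The infimum may be a left limit at a jump, hence `IsGLB` instead of `IsLeast`. -/
theorem isGLB_path_image_Icc (hc : 0 < c) (hτ : ∀ i, 0 < τ i)
    (hx : ∀ m t, epoch τ m ≤ t → t < epoch τ (m + 1) →
      x t = ∑ i ∈ Finset.range m, U i - c * t)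
    (m : ℕ) {t : ℝ} (h1 : epoch τ m ≤ t) (h2 : t < epoch τ (m + 1))
    (hm : IsGLB (x '' Set.Icc 0 (epoch τ m)) (x (epoch τ m) - workload c τ U m)) :
    IsGLB (x '' Set.Icc 0 t) (x t - max (workload c τ U m - c * (t - epoch τ m)) 0) := by
  have hl : IsLeast (x '' Set.Icc (epoch τ m) t) (x t) := by
    refine ⟨⟨t, ⟨h1, le_rfl⟩, rfl⟩, ?_⟩
    rintro _ ⟨s, hs, rfl⟩
    rw [path_sub hx hτ h1 h2, path_sub hx hτ hs.1 (hs.2.trans_lt h2)]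
    have := mul_le_mul_of_nonneg_left hs.2 hc.le
    linarith
  have hu := hm.union hl.isGLB
  rw [← Set.image_union, Set.Icc_union_Icc_eq_Icc (epoch_nonneg hτ m) h1] at hu
  suffices e : x t - max (workload c τ U m - c * (t - epoch τ m)) 0 =
      min (x (epoch τ m) - workload c τ U m) (x t) by rw [e]; exact hu
  rw [path_sub hx hτ h1 h2]
  rcases le_total (workload c τ U m - c * (t - epoch τ m)) 0 with h | h
  · rw [max_eq_right h, min_eq_right (by linarith), sub_zero]
  · rw [max_eq_left h, min_eq_left (by linarith)]; ring

/-- The gap above the running infimum obeys the recursion that defines `workload`. -/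
theorem isGLB_path_image_Icc_epoch (hc : 0 < c) (hτ : ∀ i, 0 < τ i)
    (hx : ∀ m t, epoch τ m ≤ t → t < epoch τ (m + 1) →
      x t = ∑ i ∈ Finset.range m, U i - c * t) (hU : ∀ i, 0 < U i) (m : ℕ) :
    IsGLB (x '' Set.Icc 0 (epoch τ m)) (x (epoch τ m) - workload c τ U m) := by
  induction m with
  | zero => simp [epoch, workload]
  | succ m ih =>
    have hlt : epoch τ m < epoch τ (m + 1) := epoch_strictMono hτ m.lt_succ_self
    have hg : IsGLB (x '' Set.Ico (epoch τ m) (epoch τ (m + 1))) (x (epoch τ m) - c * τ m) := by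
      constructor
      · rintro _ ⟨s, hs, rfl⟩
        rw [path_sub hx hτ hs.1 hs.2]
        have := mul_le_mul_of_nonneg_left hs.2.le hc.le
        rw [epoch_succ] at this
        linarith
      · intro b hb
        by_contra! hlt'
        -- A time so close to the next jump that the path has already fallen below the alleged lower
        -- bound `b`; the infimum is the left limit there.
        obtain ⟨s, hs1, hs2⟩ := exists_between (max_lt hlt
          (sub_lt_self (epoch τ (m + 1)) (div_pos (sub_pos.2 hlt') hc)))
        have hs1' := max_lt_iff.1 hs1
        have := hb ⟨s, ⟨hs1'.1.le, hs2⟩, rfl⟩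
        rw [path_sub hx hτ hs1'.1.le hs2] at this
        have h3 := hs1'.2
        rw [sub_lt_comm, lt_div_iff₀ hc, epoch_succ] at h3
        linarith
    have hu := (ih.union hg).union (isGLB_singleton (a := x (epoch τ (m + 1))))
    rw [← Set.image_union, ← Set.image_singleton, ← Set.image_union,
      Set.Icc_union_Ico_eq_Ico (epoch_nonneg hτ m) hlt,
      Set.Ico_union_right (epoch_nonneg hτ (m + 1))] at hu
    suffices e : x (epoch τ (m + 1)) - workload c τ U (m + 1) =
        min (min (x (epoch τ m) - workload c τ U m) (x (epoch τ m) - c * τ m))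
          (x (epoch τ (m + 1))) by rw [e]; exact hu
    rw [path_epoch_succ hx hτ]
    simp only [workload]
    -- Jumps go up, so the value after the jump lies above the left limit and does not affect the
    -- minimum.
    rw [min_eq_left ((min_le_right _ _).trans (by linarith [hU m]))]
    rcases le_total (workload c τ U m - c * τ m) 0 with h | h
    · rw [max_eq_right h, min_eq_right (by linarith)]; ring
    · rw [max_eq_left h, min_eq_left (by linarith)]; ring

theorem runInf_eq_iff (hc : 0 < c) (hτ : ∀ i, 0 < τ i)
    (hx : ∀ m t, epoch τ m ≤ t → t < epoch τ (m + 1) →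
      x t = ∑ i ∈ Finset.range m, U i - c * t) (hU : ∀ i, 0 < U i)
    {m : ℕ} {t : ℝ} (h1 : epoch τ m ≤ t) (h2 : t < epoch τ (m + 1)) :
    runInf x t = x t ↔ emptyingTime c τ U m ≤ t := by
  have h := (isGLB_path_image_Icc hc hτ hx m h1 h2
    (isGLB_path_image_Icc_epoch hc hτ hx hU m)).csInf_eq
      ⟨x t, t, ⟨(epoch_nonneg hτ m).trans h1, le_rfl⟩, rfl⟩
  rw [runInf, h, sub_eq_self, max_eq_right_iff, emptyingTime, ← le_sub_iff_add_le', div_le_iff₀ hc,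
    sub_nonpos, mul_comm]

theorem emptyingTime_lt_iff (hc : 0 < c) (m : ℕ) :
    emptyingTime c τ U m < epoch τ (m + 1) ↔ workload c τ U m < c * τ m := by
  rw [emptyingTime, epoch_succ, add_lt_add_iff_left, div_lt_iff₀ hc, mul_comm]

theorem epoch_le_emptyingTime (hc : 0 < c) (hU : ∀ i, 0 < U i) (m : ℕ) :
    epoch τ m ≤ emptyingTime c τ U m :=
  le_add_of_nonneg_right (div_nonneg (workload_nonneg hU m) hc.le)

theorem epoch_succ_lt_emptyingTime (hc : 0 < c) (hU : ∀ i, 0 < U i) (m : ℕ) :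
    epoch τ (m + 1) < emptyingTime c τ U (m + 1) :=
  lt_add_of_pos_right _ (div_pos (workload_succ_pos hU m) hc)

/-- An empty queue stays empty until the next jump. The strict inequality matters: a workload that
would run out exactly at a jump time is never seen empty. -/
theorem nextStart_emptyingTime (hc : 0 < c) (hτ : ∀ i, 0 < τ i)
    (hx : ∀ m t, epoch τ m ≤ t → t < epoch τ (m + 1) →
      x t = ∑ i ∈ Finset.range m, U i - c * t) (hU : ∀ i, 0 < U i)
    {m : ℕ} (hm : workload c τ U m < c * τ m) :
    nextStart x (emptyingTime c τ U m) = epoch τ (m + 1) := by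
  refine IsLeast.csInf_eq ⟨⟨(emptyingTime_lt_iff hc m).2 hm, ?_⟩, ?_⟩
  · rw [ne_eq, runInf_eq_iff hc hτ hx hU le_rfl (epoch_strictMono hτ (m + 1).lt_succ_self), not_le]
    exact epoch_succ_lt_emptyingTime hc hU m
  · rintro t ⟨h1, h2⟩
    by_contra! h3
    exact h2 ((runInf_eq_iff hc hτ hx hU ((epoch_le_emptyingTime hc hU m).trans h1.le) h3).2 h1.le)

theorem nextEnd_epoch (hc : 0 < c) (hτ : ∀ i, 0 < τ i)
    (hx : ∀ m t, epoch τ m ≤ t → t < epoch τ (m + 1) →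
      x t = ∑ i ∈ Finset.range m, U i - c * t) (hU : ∀ i, 0 < U i)
    (hlim : Tendsto (epoch τ) atTop atTop)
    {m m' : ℕ} (hlt : m < m') (hm' : workload c τ U m' < c * τ m')
    (hmin : ∀ i, m < i → workload c τ U i < c * τ i → m' ≤ i) :
    nextEnd x (epoch τ (m + 1)) = emptyingTime c τ U m' := by
  have hmono := epoch_strictMono hτ
  have hend := (emptyingTime_lt_iff hc m').2 hm'
  refine IsLeast.csInf_eq ⟨⟨?_, ?_⟩, ?_⟩
  · obtain ⟨i, rfl⟩ : ∃ i, m' = i + 1 := ⟨m' - 1, by omega⟩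
    exact (hmono.monotone (by omega)).trans_lt (epoch_succ_lt_emptyingTime hc hU i)
  · exact (runInf_eq_iff hc hτ hx hU (epoch_le_emptyingTime hc hU m') hend).2 le_rfl
  · rintro t ⟨h1, h2⟩
    obtain ⟨l, hl1, hl2⟩ := exists_epoch_le_lt hlim ((epoch_nonneg hτ _).trans h1.le)
    have h3 := (runInf_eq_iff hc hτ hx hU hl1 hl2).1 h2
    have h4 : m + 1 < l + 1 := hmono.lt_iff_lt.1 (h1.trans hl2)
    have h5 := hmin l (by omega) ((emptyingTime_lt_iff hc l).1 (h3.trans_lt hl2))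
    rcases h5.eq_or_lt with rfl | h5
    · exact h3
    · exact hend.le.trans ((hmono.monotone (by omega : m' + 1 ≤ l)).trans hl1)

/-- Excursion ends correspond to the indices `m` for which the queue empties before jump `m + 1`.
Index 0 is one of them, as the queue starts empty, and accounts for `R^(0) = 0`. -/
theorem excEnd_eq_emptyingTime (hc : 0 < c) (hτ : ∀ i, 0 < τ i)
    (hx : ∀ m t, epoch τ m ≤ t → t < epoch τ (m + 1) →
      x t = ∑ i ∈ Finset.range m, U i - c * t) (hU : ∀ i, 0 < U i)
    (hlim : Tendsto (epoch τ) atTop atTop)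
    (hinf : {m | workload c τ U m < c * τ m}.Infinite) (i : ℕ) :
    excEnd x i = emptyingTime c τ U (Nat.nth (fun m => workload c τ U m < c * τ m) i) := by
  induction i with
  | zero =>
    rw [Nat.nth_zero_of_zero (by simpa [workload] using mul_pos hc (hτ 0))]
    simp [excEnd, emptyingTime, workload, epoch]
  | succ i ih =>
    rw [excEnd, ih, nextStart_emptyingTime hc hτ hx hU (Nat.nth_mem_of_infinite hinf i)]
    refine nextEnd_epoch hc hτ hx hU hlim (Nat.nth_strictMono hinf i.lt_succ_self)
      (Nat.nth_mem_of_infinite hinf _) fun l hl hp => ?_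
    obtain ⟨a, rfl⟩ : l ∈ Set.range (Nat.nth fun m => workload c τ U m < c * τ m) := by
      rw [Nat.range_nth_of_infinite hinf]; exact hp
    exact (Nat.nth_strictMono hinf).monotone
      (Nat.succ_le_of_lt ((Nat.nth_strictMono hinf).lt_iff_lt.1 hl))

theorem excStart_eq_epoch (hc : 0 < c) (hτ : ∀ i, 0 < τ i)
    (hx : ∀ m t, epoch τ m ≤ t → t < epoch τ (m + 1) →
      x t = ∑ i ∈ Finset.range m, U i - c * t) (hU : ∀ i, 0 < U i)
    (hlim : Tendsto (epoch τ) atTop atTop)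
    (hinf : {m | workload c τ U m < c * τ m}.Infinite) (i : ℕ) :
    excStart x (i + 1) =
      epoch τ (Nat.nth (fun m => workload c τ U m < c * τ m) i + 1) := by
  rw [excStart, Nat.add_sub_cancel, excEnd_eq_emptyingTime hc hτ hx hU hlim hinf,
    nextStart_emptyingTime hc hτ hx hU (Nat.nth_mem_of_infinite hinf i)]

/-- If the queue emptied only finitely often, the path minus the workload would be constant at all
later jumps, which bounds the path from below there and contradicts the drift. -/
theorem infinite_workload_lt (hτ : ∀ i, 0 < τ i)
    (hx : ∀ m t, epoch τ m ≤ t → t < epoch τ (m + 1) →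
      x t = ∑ i ∈ Finset.range m, U i - c * t) (hU : ∀ i, 0 < U i)
    (hlim : Tendsto (epoch τ) atTop atTop) (hdrift : Tendsto x atTop atBot) :
    {m | workload c τ U m < c * τ m}.Infinite := by
  intro hfin
  obtain ⟨M, hM⟩ := hfin.bddAbove
  have hconst : ∀ i, x (epoch τ (M + 1 + i)) - workload c τ U (M + 1 + i) =
      x (epoch τ (M + 1)) - workload c τ U (M + 1) := by
    intro i
    induction i with
    | zero => rfl
    | succ i ih =>
      rw [← ih, ← add_assoc, path_epoch_succ hx hτ]
      have : c * τ (M + 1 + i) ≤ workload c τ U (M + 1 + i) := by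
        by_contra! h
        have : M + 1 + i ≤ M := hM h
        omega
      simp only [workload]
      rw [max_eq_left (by linarith)]
      ring
  have h1 := (hdrift.comp (hlim.comp (tendsto_add_atTop_nat (M + 1)))).eventually_lt_atBot
    (x (epoch τ (M + 1)) - workload c τ U (M + 1))
  obtain ⟨i, hi⟩ := h1.exists
  simp only [Function.comp_apply] at hi
  rw [add_comm i] at hi
  linarith [hconst i, workload_nonneg (c := c) (τ := τ) hU (M + 1 + i)]

/-- The jumps only push the path up, so the drift to `-∞` must come from the rate. -/
theorem rate_pos_of_tendsto_atBot (hU : ∀ i, 0 < U i)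
    (hx : ∀ m t, epoch τ m ≤ t → t < epoch τ (m + 1) →
      x t = ∑ i ∈ Finset.range m, U i - c * t)
    (hlim : Tendsto (epoch τ) atTop atTop) (hdrift : Tendsto x atTop atBot) : 0 < c := by
  by_contra! hc
  obtain ⟨t, ht, ht0⟩ := ((hdrift.eventually_lt_atBot 0).and (eventually_ge_atTop 0)).exists
  obtain ⟨m, h1, h2⟩ := exists_epoch_le_lt hlim ht0
  rw [hx m t h1 h2] at ht
  have : 0 ≤ ∑ i ∈ Finset.range m, U i := Finset.sum_nonneg fun i _ => (hU i).le
  nlinarith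

end Path

/-- The last end of an excursion of the path with rate `c'` not later than the first end of an
excursion of the path with the smaller rate `c`. -/
theorem sSup_excEnd_eq {c c' : ℝ} {τ U : ℕ → ℝ} {x x' : ℝ → ℝ} (hc : 0 < c) (hcc : c ≤ c')
    (hτ : ∀ i, 0 < τ i) (hU : ∀ i, 0 < U i) (hlim : Tendsto (epoch τ) atTop atTop)
    (hx : ∀ m t, epoch τ m ≤ t → t < epoch τ (m + 1) →
      x t = ∑ i ∈ Finset.range m, U i - c * t)
    (hx' : ∀ m t, epoch τ m ≤ t → t < epoch τ (m + 1) →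
      x' t = ∑ i ∈ Finset.range m, U i - c' * t)
    (hdrift : Tendsto x atTop atBot) (hdrift' : Tendsto x' atTop atBot) :
    sSup {r : ℝ | ∃ i : ℕ, 1 ≤ i ∧ r = excEnd x' i ∧ r ≤ excEnd x 1} =
      emptyingTime c' τ U (Nat.nth (fun m => workload c τ U m < c * τ m) 1) := by
  have hc' := hc.trans_le hcc
  have hinf := infinite_workload_lt hτ hx hU hlim hdrift
  have hinf' := infinite_workload_lt hτ hx' hU hlim hdrift'
  have hE := excEnd_eq_emptyingTime hc hτ hx hU hlim hinf
  have hE' := excEnd_eq_emptyingTime hc' hτ hx' hU hlim hinf'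
  set p := fun m => workload c τ U m < c * τ m
  set p' := fun m => workload c' τ U m < c' * τ m
  set N := Nat.nth p 1
  have hN : p N := Nat.nth_mem_of_infinite hinf 1
  have hN0 : N ≠ 0 := ((Nat.zero_le _).trans_lt (Nat.nth_strictMono hinf zero_lt_one)).ne'
  -- The faster queue empties no later after the same jump `N`, hence before the next one. This is
  -- the maximum sought, since every admissible end has an index at most `N`.
  have hle : emptyingTime c' τ U N ≤ emptyingTime c τ U N :=
    add_le_add le_rfl (workload_div_anti hc hτ hU hcc N)
  have hN' : p' N := (emptyingTime_lt_iff hc' N).1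
    (hle.trans_lt ((emptyingTime_lt_iff hc N).2 hN))
  refine IsGreatest.csSup_eq ⟨?_, ?_⟩
  · obtain ⟨a, ha⟩ : N ∈ Set.range (Nat.nth p') := by
      rw [Nat.range_nth_of_infinite hinf']; exact hN'
    refine ⟨a, Nat.one_le_iff_ne_zero.2 ?_, by rw [hE', ha], by rw [hE]; exact hle⟩
    rintro rfl
    rw [Nat.nth_zero_of_zero (by simpa [p', workload] using mul_pos hc' (hτ 0))] at ha
    exact hN0 ha.symm
  · rintro _ ⟨i, -, rfl, hi⟩
    rw [hE'] at hi ⊢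
    rw [hE] at hi
    set l := Nat.nth p' i
    have hl : p' l := Nat.nth_mem_of_infinite hinf' i
    have h1 : epoch τ l < epoch τ (N + 1) := ((epoch_le_emptyingTime hc' hU l).trans hi).trans_lt
      ((emptyingTime_lt_iff hc N).2 hN)
    have h2 := (epoch_strictMono hτ).lt_iff_lt.1 h1
    rcases (Nat.lt_succ_iff.1 h2).eq_or_lt with h | h
    · rw [h]
    · exact ((emptyingTime_lt_iff hc' l).2 hl).le.trans
        (((epoch_strictMono hτ).monotone h).trans (epoch_le_emptyingTime hc' hU N))

/-- The last beginning of an excursion not later than the end of the first excursion. -/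
theorem sSup_excStart_eq {c : ℝ} {τ U : ℕ → ℝ} {x : ℝ → ℝ} (hc : 0 < c)
    (hτ : ∀ i, 0 < τ i) (hU : ∀ i, 0 < U i) (hlim : Tendsto (epoch τ) atTop atTop)
    (hx : ∀ m t, epoch τ m ≤ t → t < epoch τ (m + 1) →
      x t = ∑ i ∈ Finset.range m, U i - c * t)
    (hdrift : Tendsto x atTop atBot) :
    sSup {s : ℝ | ∃ i : ℕ, 1 ≤ i ∧ s = excStart x i ∧ s ≤ excEnd x 1} = epoch τ 1 := by
  have hinf := infinite_workload_lt hτ hx hU hlim hdrift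
  have hE := excEnd_eq_emptyingTime hc hτ hx hU hlim hinf
  have hS := excStart_eq_epoch hc hτ hx hU hlim hinf
  have hmono := epoch_strictMono hτ
  set p := fun m => workload c τ U m < c * τ m
  have h0 : Nat.nth p 0 = 0 :=
    Nat.nth_zero_of_zero (by simpa [p, workload] using mul_pos hc (hτ 0))
  have hN0 : 0 < Nat.nth p 1 := (Nat.zero_le _).trans_lt (Nat.nth_strictMono hinf zero_lt_one)
  refine IsGreatest.csSup_eq ⟨⟨1, le_rfl, by rw [hS 0, h0], ?_⟩, ?_⟩
  · rw [hE]
    exact (hmono.monotone hN0).trans (epoch_le_emptyingTime hc hU _)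
  · rintro _ ⟨i, hi, rfl, hle⟩
    obtain ⟨i, rfl⟩ : ∃ a, i = a + 1 := ⟨i - 1, by omega⟩
    rw [hS] at hle ⊢
    rw [hE] at hle
    have h1 := hmono.lt_iff_lt.1 (hle.trans_lt
      ((emptyingTime_lt_iff hc _).2 (Nat.nth_mem_of_infinite hinf 1)))
    have h2 := (Nat.nth_strictMono hinf).lt_iff_lt.1 (Nat.lt_of_succ_lt_succ h1)
    obtain rfl : i = 0 := by omega
    rw [h0]

/-! ### The mean over one exponential waiting time and one jump -/

theorem integral_expMeasure {lam : ℝ} (hlam : 0 < lam) (f : ℝ → ℝ) :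
    ∫ t, f t ∂(expMeasure lam) = ∫ t in Set.Ioi 0, lam * Real.exp (-lam * t) * f t := by
  have h : expMeasure lam = volume.withDensity (exponentialPDF lam) := rfl
  have hm : Measurable (exponentialPDF lam) :=
    (measurable_exponentialPDFReal lam).ennreal_ofReal
  rw [h, integral_withDensity_eq_integral_toReal_smul hm
    (Eventually.of_forall fun _ => ENNReal.ofReal_lt_top), ← integral_Ici_eq_integral_Ioi,
    ← integral_indicator measurableSet_Ici]
  congr 1
  ext t
  by_cases ht : 0 ≤ t
  · rw [Set.indicator_of_mem (by exact ht), exponentialPDF_of_nonneg ht,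
      ENNReal.toReal_ofReal (by positivity), smul_eq_mul, neg_mul]
  · rw [Set.indicator_of_notMem (by exact ht), exponentialPDF_of_neg (not_le.1 ht)]
    simp

/-- Mean of a function of an exponential time `t` that is constant for `t > a`. -/
theorem integral_expMeasure_ite {lam a C : ℝ} (hlam : 0 < lam) (ha : 0 ≤ a) {g : ℝ → ℝ}
    (hg : Continuous g) :
    ∫ t, (if a < t then C else g t) ∂(expMeasure lam) =
      Real.exp (-lam * a) * C + ∫ t in (0)..a, lam * Real.exp (-lam * t) * g t := by
  rw [integral_expMeasure hlam, ← Set.Ioc_union_Ioi_eq_Ioi ha]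
  have h1 : ∀ t ∈ Set.Ioc 0 a, lam * Real.exp (-lam * t) * (if a < t then C else g t) =
      lam * Real.exp (-lam * t) * g t := fun t ht => by rw [if_neg ht.2.not_gt]
  have h2 : ∀ t ∈ Set.Ioi a, lam * Real.exp (-lam * t) * (if a < t then C else g t) =
      (lam * C) * Real.exp (-lam * t) := fun t ht => by rw [if_pos (Set.mem_Ioi.1 ht)]; ring
  have i1 : IntegrableOn (fun t => lam * Real.exp (-lam * t) * g t) (Set.Ioc 0 a) :=
    (Continuous.integrableOn_Icc (by fun_prop)).mono_set Set.Ioc_subset_Icc_self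
  have i2 : IntegrableOn (fun t => (lam * C) * Real.exp (-lam * t)) (Set.Ioi a) :=
    (integrableOn_exp_mul_Ioi (neg_lt_zero.2 hlam) a).const_mul _
  rw [setIntegral_union (Set.Ioc_disjoint_Ioi le_rfl) measurableSet_Ioi
    (i1.congr_fun (fun t ht => (h1 t ht).symm) measurableSet_Ioc)
    (i2.congr_fun (fun t ht => (h2 t ht).symm) measurableSet_Ioi),
    setIntegral_congr_fun measurableSet_Ioc h1, setIntegral_congr_fun measurableSet_Ioi h2,
    integral_const_mul, integral_exp_mul_Ioi (neg_lt_zero.2 hlam),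
    intervalIntegral.integral_of_le ha]
  field_simp
  ring

/-- The reward collected when the workloads `y` are served without a further jump. -/
noncomputable def finalReward (c β : ℕ → ℝ) (k : ℕ) (y : ℕ → ℝ) : ℝ :=
  Real.exp (-∑ i ∈ Finset.range k, β i * (y (i + 1) / c (i + 1) - y i / c i))

/-- The discounted reward or continuation value when, from the workloads `y`, the next jump has
size `u` and occurs after a time `t`. -/
noncomputable def stepValue (c β θ μ η A : ℕ → ℝ) (k : ℕ) (y : ℕ → ℝ) (t u : ℝ) : ℝ :=
  if y k / c k < t then Real.exp (-θ k * (y k / c k)) * finalReward c β k y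
  else Real.exp (-θ k * t) * expMix μ η A 1 k fun j => max (y j - c j * t) 0 + u

theorem integral_stepValue {lam : ℝ} (hlam : 0 < lam) {c β θ μ η A φ : ℕ → ℝ} (k : ℕ)
    (ν : Measure ℝ) [IsProbabilityMeasure ν]
    (hint : ∀ j ≤ k, Integrable (fun u => Real.exp (-η j * u)) ν)
    (hφ : ∀ j ≤ k, ∫ u, Real.exp (-η j * u) ∂ν = φ j)
    (hc : ∀ j ≤ k, 0 < c j)
    (hη : ∀ j ≤ k, c j * η j = θ j + lam * (1 - φ j))
    (hθ : ∀ j < k, θ j = θ (j + 1) + μ j * (c j - c (j + 1)))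
    (hμ : ∀ j < k, μ j * c (j + 1) = lam + θ (j + 1) + β j)
    (hA : ∀ j < k, A j * (β j + lam * φ j) = lam * expMix μ η A φ j 0)
    (y : ℕ → ℝ) (hy : ∀ j ≤ k, 0 ≤ y j) (hm : ∀ j < k, y j / c j ≤ y (j + 1) / c (j + 1)) :
    ∫ t, ∫ u, stepValue c β θ μ η A k y t u ∂ν ∂(expMeasure lam) = expMix μ η A 1 k y := by
  have h1 : ∀ t, ∫ u, stepValue c β θ μ η A k y t u ∂ν =
      if y k / c k < t then Real.exp (-θ k * (y k / c k)) * finalReward c β k y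
      else Real.exp (-θ k * t) * expMix μ η A φ k fun j => max (y j - c j * t) 0 := by
    intro t
    unfold stepValue
    split_ifs with h
    · simp
    · rw [integral_const_mul,
        (integral_expMix_add μ η A φ ν k hint hφ fun j => max (y j - c j * t) 0).2]
  simp_rw [h1]
  have hcont : Continuous fun t : ℝ => expMix μ η A φ k fun j => max (y j - c j * t) 0 :=
    (continuous_expMix μ η A φ k).comp (by fun_prop)
  rw [integral_expMeasure_ite hlam (div_nonneg (hy k le_rfl) (hc k le_rfl).le)
    (g := fun t => Real.exp (-θ k * t) * expMix μ η A φ k fun j => max (y j - c j * t) 0)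
    (by fun_prop), expMix_eq_add_integral_firstJump k hc hη hθ hμ hA y hy hm, ← mul_assoc,
    ← Real.exp_add]
  congr 1
  · rw [finalReward]; ring_nf
  · congr 1
    ext t
    rw [← mul_assoc, mul_assoc lam, ← Real.exp_add]
    ring_nf

/-! ### Independence of the past from the next waiting time and jump -/

section Independence

variable {Ω : Type*} {mΩ : MeasurableSpace Ω} {P : Measure Ω}

/-- The σ-algebra of the first `m` interarrival times and jump sizes. -/
abbrev pastSigma (τ U : ℕ → Ω → ℝ) (m : ℕ) : MeasurableSpace Ω :=
  ⨆ i ∈ {i : ℕ ⊕ ℕ | Sum.elim id id i < m},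
    MeasurableSpace.comap (Sum.elim τ U i) inferInstance

theorem pastSigma_le {τ U : ℕ → Ω → ℝ} (hτ : ∀ i, Measurable (τ i))
    (hU : ∀ i, Measurable (U i)) (m : ℕ) : pastSigma τ U m ≤ mΩ :=
  iSup₂_le fun i _ => by
    cases i with
    | inl i => exact (hτ i).comap_le
    | inr i => exact (hU i).comap_le

theorem measurable_pastSigma_left (τ U : ℕ → Ω → ℝ) {i m : ℕ} (h : i < m) :
    Measurable[pastSigma τ U m] (τ i) :=
  Measurable.of_comap_le
    (le_iSup₂_of_le (f := fun (i : ℕ ⊕ ℕ) (_ : i ∈ {i : ℕ ⊕ ℕ | Sum.elim id id i < m}) =>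
      MeasurableSpace.comap (Sum.elim τ U i) inferInstance) (Sum.inl i) h le_rfl)

theorem measurable_pastSigma_right (τ U : ℕ → Ω → ℝ) {i m : ℕ} (h : i < m) :
    Measurable[pastSigma τ U m] (U i) :=
  Measurable.of_comap_le
    (le_iSup₂_of_le (f := fun (i : ℕ ⊕ ℕ) (_ : i ∈ {i : ℕ ⊕ ℕ | Sum.elim id id i < m}) =>
      MeasurableSpace.comap (Sum.elim τ U i) inferInstance) (Sum.inr i) h le_rfl)

theorem indepFun_of_measurable_pastSigma {τ U : ℕ → Ω → ℝ} (hτ : ∀ i, Measurable (τ i))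
    (hU : ∀ i, Measurable (U i)) (hind : iIndepFun (Sum.elim τ U) P) {α : Type*}
    [MeasurableSpace α] {m : ℕ} {S : Ω → α} (hS : Measurable[pastSigma τ U m] S) :
    IndepFun S (fun ω => (τ m ω, U m ω)) P := by
  have hle : ∀ i : ℕ ⊕ ℕ, MeasurableSpace.comap (Sum.elim τ U i) inferInstance ≤ mΩ := by
    rintro (i | i)
    exacts [(hτ i).comap_le, (hU i).comap_le]
  have h := indep_iSup_of_disjoint hle hind
    (S := {i : ℕ ⊕ ℕ | Sum.elim id id i < m}) (T := {i : ℕ ⊕ ℕ | Sum.elim id id i = m})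
    (Set.disjoint_left.2 fun i h1 h2 => (ne_of_lt h1) h2)
  rw [IndepFun_iff_Indep]
  refine indep_of_indep_of_le_left (indep_of_indep_of_le_right h ?_) hS.comap_le
  refine Measurable.comap_le (Measurable.prodMk ?_ ?_)
  · exact Measurable.of_comap_le
      (le_iSup₂_of_le (f := fun (i : ℕ ⊕ ℕ) (_ : i ∈ {i : ℕ ⊕ ℕ | Sum.elim id id i = m}) =>
        MeasurableSpace.comap (Sum.elim τ U i) inferInstance) (Sum.inl m) rfl le_rfl)
  · exact Measurable.of_comap_le
      (le_iSup₂_of_le (f := fun (i : ℕ ⊕ ℕ) (_ : i ∈ {i : ℕ ⊕ ℕ | Sum.elim id id i = m}) =>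
        MeasurableSpace.comap (Sum.elim τ U i) inferInstance) (Sum.inr m) rfl le_rfl)

/-- Integrating out an independent pair. -/
theorem integral_comp_of_indepFun [IsProbabilityMeasure P] {α : Type*} [MeasurableSpace α]
    {S : Ω → α} {τ U : Ω → ℝ} {κ ν : Measure ℝ} [IsProbabilityMeasure κ] [IsProbabilityMeasure ν]
    (hS : Measurable S) (hτ : Measurable τ) (hU : Measurable U)
    (hSX : IndepFun S (fun ω => (τ ω, U ω)) P) (hτU : IndepFun τ U P)
    (hτlaw : P.map τ = κ) (hUlaw : P.map U = ν) {f : α → ℝ → ℝ → ℝ} {g : α → ℝ}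
    (hf : Measurable fun p : α × ℝ × ℝ => f p.1 p.2.1 p.2.2)
    -- The bound and the identity are asked only along the sample values of `S`, because the value
    -- function is controlled only for ordered nonnegative workloads.
    {C : ℝ} (hC : ∀ᵐ ω ∂P, |f (S ω) (τ ω) (U ω)| ≤ C)
    (hfg : ∀ᵐ ω ∂P, ∫ t, ∫ u, f (S ω) t u ∂ν ∂κ = g (S ω)) :
    ∫ ω, f (S ω) (τ ω) (U ω) ∂P = ∫ ω, g (S ω) ∂P := by
  have hX : Measurable fun ω => (τ ω, U ω) := hτ.prodMk hU
  have e1 : P.map (fun ω => (τ ω, U ω)) = κ.prod ν := by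
    rw [(indepFun_iff_map_prod_eq_prod_map_map hτ.aemeasurable hU.aemeasurable).1 hτU,
      hτlaw, hUlaw]
  have e2 : P.map (fun ω => (S ω, (τ ω, U ω))) = (P.map S).prod (κ.prod ν) := by
    rw [(indepFun_iff_map_prod_eq_prod_map_map hS.aemeasurable hX.aemeasurable).1 hSX, e1]
  have : IsProbabilityMeasure (P.map S) := Measure.isProbabilityMeasure_map hS.aemeasurable
  have hint : Integrable (fun p : α × ℝ × ℝ => f p.1 p.2.1 p.2.2)
      ((P.map S).prod (κ.prod ν)) := by
    rw [← e2]
    refine (integrable_map_measure hf.aestronglyMeasurable (hS.prodMk hX).aemeasurable).2 ?_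
    exact Integrable.of_bound (hf.comp (hS.prodMk hX)).aestronglyMeasurable C hC
  have e3 : ∫ ω, f (S ω) (τ ω) (U ω) ∂P =
      ∫ p, f p.1 p.2.1 p.2.2 ∂((P.map S).prod (κ.prod ν)) := by
    rw [← e2, integral_map (hS.prodMk hX).aemeasurable hf.aestronglyMeasurable]
  rw [e3, integral_prod _ hint]
  have e4 : ∀ᵐ s ∂(P.map S), ∫ p, f s p.1 p.2 ∂(κ.prod ν) = ∫ t, ∫ u, f s t u ∂ν ∂κ := by
    filter_upwards [hint.prod_right_ae] with s hs
    exact integral_prod _ hs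
  rw [integral_congr_ae e4, integral_map hS.aemeasurable]
  · exact integral_congr_ae hfg
  · exact (hint.integral_prod_left.aestronglyMeasurable).congr e4

end Independence

/-! ### The value process and its constant mean -/

/-- The discount factor at the `(m + 1)`-st jump, set to `0` once the first excursion is over. -/
noncomputable def survival (c γ : ℝ) (τ U : ℕ → ℝ) : ℕ → ℝ
  | 0 => 1
  | m + 1 => survival c γ τ U m *
      if workload c τ U (m + 1) / c < τ (m + 1) then 0 else Real.exp (-γ * τ (m + 1))

/-- The reward of the first excursion if it is over by the `(m + 1)`-st jump, and `0` otherwise. -/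
noncomputable def payoff (c β : ℕ → ℝ) (γ : ℝ) (k : ℕ) (τ U : ℕ → ℝ) : ℕ → ℝ
  | 0 => 0
  | m + 1 => payoff c β γ k τ U m + survival (c k) γ τ U m *
      if workload (c k) τ U (m + 1) / c k < τ (m + 1) then
        Real.exp (-γ * (workload (c k) τ U (m + 1) / c k)) *
          finalReward c β k fun j => workload (c j) τ U (m + 1)
      else 0

theorem finalReward_pos (c β : ℕ → ℝ) (k : ℕ) (y : ℕ → ℝ) : 0 < finalReward c β k y :=
  Real.exp_pos _

theorem finalReward_le_one {c β : ℕ → ℝ} {k : ℕ} {y : ℕ → ℝ} (hβ : ∀ j < k, 0 ≤ β j)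
    (hm : ∀ j < k, y j / c j ≤ y (j + 1) / c (j + 1)) : finalReward c β k y ≤ 1 := by
  refine Real.exp_le_one_iff.2 (neg_nonpos.2 (Finset.sum_nonneg fun i hi => ?_))
  rw [Finset.mem_range] at hi
  exact mul_nonneg (hβ i hi) (sub_nonneg.2 (hm i hi))

/-- At each jump the surviving discount either shrinks or is paid out once, times a reward at most
1; the total cannot grow. -/
theorem survival_payoff_bounds {c β : ℕ → ℝ} {γ : ℝ} {k : ℕ} {τ U : ℕ → ℝ} (hγ : 0 ≤ γ)
    (hβ : ∀ j < k, 0 ≤ β j) (hc : ∀ j ≤ k, 0 < c j) (hanti : ∀ j < k, c (j + 1) ≤ c j)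
    (hτ : ∀ i, 0 < τ i) (hU : ∀ i, 0 < U i) (m : ℕ) :
    0 ≤ survival (c k) γ τ U m ∧ 0 ≤ payoff c β γ k τ U m ∧
      survival (c k) γ τ U m + payoff c β γ k τ U m ≤ 1 := by
  induction m with
  | zero => simp [survival, payoff]
  | succ m ih =>
    obtain ⟨h1, h2, h3⟩ := ih
    have hR0 := finalReward_pos c β k fun j => workload (c j) τ U (m + 1)
    have hR1 : finalReward c β k (fun j => workload (c j) τ U (m + 1)) ≤ 1 :=
      finalReward_le_one hβ fun j hj =>
        workload_div_anti (hc (j + 1) (by omega)) hτ hU (hanti j hj) (m + 1)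
    simp only [survival, payoff]
    split_ifs with h
    · have hw := div_nonneg (workload_nonneg (c := c k) (τ := τ) hU (m + 1)) (hc k le_rfl).le
      have he : Real.exp (-γ * (workload (c k) τ U (m + 1) / c k)) ≤ 1 :=
        Real.exp_le_one_iff.2 (by nlinarith)
      have hp : Real.exp (-γ * (workload (c k) τ U (m + 1) / c k)) *
          finalReward c β k (fun j => workload (c j) τ U (m + 1)) ≤ 1 :=
        mul_le_one₀ he hR0.le hR1
      refine ⟨by simp, by positivity, ?_⟩
      have := mul_le_mul_of_nonneg_left hp h1
      linarith
    · have he : Real.exp (-γ * τ (m + 1)) ≤ 1 :=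
        Real.exp_le_one_iff.2 (by nlinarith [hτ (m + 1)])
      refine ⟨by positivity, by simpa using h2, ?_⟩
      have := mul_le_mul_of_nonneg_left he h1
      linarith

/-- Up to the end of the first excursion the discount factor is the expected one. -/
theorem survival_eq_exp {c γ : ℝ} {τ U : ℕ → ℝ} {N : ℕ}
    (h : ∀ i < N, τ (i + 1) ≤ workload c τ U (i + 1) / c) :
    ∀ m ≤ N, survival c γ τ U m = Real.exp (-γ * (epoch τ (m + 1) - epoch τ 1)) := by
  intro m hm
  induction m with
  | zero => simp [survival]
  | succ m ih =>
    rw [survival, ih (by omega), if_neg (h m (by omega)).not_gt, ← Real.exp_add,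
      epoch_succ τ (m + 1)]
    ring_nf

theorem survival_payoff_eq_of_gt {c β : ℕ → ℝ} {γ : ℝ} {k : ℕ} {τ U : ℕ → ℝ} {N : ℕ}
    (h : ∀ i < N, τ (i + 1) ≤ workload (c k) τ U (i + 1) / c k)
    (hN : workload (c k) τ U (N + 1) / c k < τ (N + 1)) (m : ℕ) (hm : N < m) :
    survival (c k) γ τ U m = 0 ∧ payoff c β γ k τ U m =
      Real.exp (-γ * (epoch τ (N + 1) - epoch τ 1 + workload (c k) τ U (N + 1) / c k)) *
        finalReward c β k fun j => workload (c j) τ U (N + 1) := by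
  have hpay : ∀ m ≤ N, payoff c β γ k τ U m = 0 := by
    intro m hm
    induction m with
    | zero => rfl
    | succ m ih => rw [payoff, ih (by omega), if_neg (h m (by omega)).not_gt]; simp
  induction m, hm using Nat.le_induction with
  | base =>
    simp only [survival, payoff]
    rw [if_pos hN, if_pos hN, hpay N le_rfl, survival_eq_exp h N le_rfl, mul_zero, zero_add,
      ← mul_assoc, ← Real.exp_add, mul_add]
    exact ⟨rfl, rfl⟩
  | succ m _ ih => simp [survival, payoff, ih.1, ih.2]

section Martingale

variable {Ω : Type*} {mΩ : MeasurableSpace Ω} {P : Measure Ω}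

theorem measurable_workload {m₀ : MeasurableSpace Ω} {τ U : ℕ → Ω → ℝ} (c : ℝ) (m : ℕ)
    (hτ : ∀ i < m, Measurable[m₀] (τ i)) (hU : ∀ i < m, Measurable[m₀] (U i)) :
    Measurable[m₀] fun ω => workload c (fun i => τ i ω) (fun i => U i ω) m := by
  induction m with
  | zero => exact measurable_const
  | succ m ih =>
    have h1 := ih (fun i hi => hτ i (by omega)) (fun i hi => hU i (by omega))
    have h2 := hτ m (by omega)
    have h3 := hU m (by omega)
    simp only [workload]
    fun_prop

theorem measurable_survival {m₀ : MeasurableSpace Ω} {τ U : ℕ → Ω → ℝ} (c γ : ℝ) (m : ℕ)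
    (hτ : ∀ i < m + 1, Measurable[m₀] (τ i)) (hU : ∀ i < m + 1, Measurable[m₀] (U i)) :
    Measurable[m₀] fun ω => survival c γ (fun i => τ i ω) (fun i => U i ω) m := by
  induction m with
  | zero => exact measurable_const
  | succ m ih =>
    have h1 := ih (fun i hi => hτ i (by omega)) (fun i hi => hU i (by omega))
    have h2 := hτ (m + 1) (by omega)
    have h3 := measurable_workload c (m + 1) (fun i hi => hτ i (by omega))
      (fun i hi => hU i (by omega))
    simp only [survival]
    exact h1.mul (Measurable.ite (measurableSet_lt (by fun_prop) h2) (by fun_prop) (by fun_prop))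

theorem measurable_finalReward (c β : ℕ → ℝ) (k : ℕ) : Measurable (finalReward c β k) := by
  unfold finalReward
  fun_prop

theorem measurable_payoff {τ U : ℕ → Ω → ℝ} (c β : ℕ → ℝ) (γ : ℝ) (k m : ℕ)
    (hτ : ∀ i, Measurable (τ i)) (hU : ∀ i, Measurable (U i)) :
    Measurable fun ω => payoff c β γ k (fun i => τ i ω) (fun i => U i ω) m := by
  induction m with
  | zero => exact measurable_const
  | succ m ih =>
    have hw : ∀ r, Measurable fun ω => workload r (fun i => τ i ω) (fun i => U i ω) (m + 1) :=
      fun r => measurable_workload r (m + 1) (fun i _ => hτ i) (fun i _ => hU i)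
    have hs := measurable_survival (c k) γ m (fun i _ => hτ i) (fun i _ => hU i)
    have hR : Measurable fun ω => finalReward c β k
        fun j => workload (c j) (fun i => τ i ω) (fun i => U i ω) (m + 1) :=
      (measurable_finalReward c β k).comp (measurable_pi_lambda _ fun j => hw (c j))
    have hk := hw (c k)
    simp only [payoff]
    exact ih.add (hs.mul (Measurable.ite (measurableSet_lt (by fun_prop) (hτ _))
      (by fun_prop) (by fun_prop)))

theorem measurable_stepValue (c β θ μ η A : ℕ → ℝ) (k : ℕ) :
    Measurable fun p : (ℕ → ℝ) × ℝ × ℝ => stepValue c β θ μ η A k p.1 p.2.1 p.2.2 := by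
  have hR : Measurable fun p : (ℕ → ℝ) × ℝ × ℝ => finalReward c β k p.1 :=
    (measurable_finalReward c β k).comp measurable_fst
  have hG : Measurable fun p : (ℕ → ℝ) × ℝ × ℝ =>
      expMix μ η A 1 k fun j => max (p.1 j - c j * p.2.1) 0 + p.2.2 :=
    ((continuous_expMix μ η A 1 k).comp (by fun_prop)).measurable
  unfold stepValue
  exact Measurable.ite (measurableSet_lt (by fun_prop) (by fun_prop)) (by fun_prop) (by fun_prop)

/-- The value process whose mean is preserved at every jump. -/
noncomputable def valueProcess (c β μ η A : ℕ → ℝ) (γ : ℝ) (k : ℕ) (τ U : ℕ → ℝ) (m : ℕ) : ℝ :=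
  payoff c β γ k τ U m + survival (c k) γ τ U m *
    expMix μ η A 1 k fun j => workload (c j) τ U (m + 1)

/-- Either the excursion is over, and the value is replaced by the reward, or the workloads move on
by their recursion. All dependence on the new pair is confined to `stepValue`. -/
theorem valueProcess_succ (c β θ μ η A : ℕ → ℝ) (k : ℕ) (τ U : ℕ → ℝ) (m : ℕ) :
    valueProcess c β μ η A (θ k) k τ U (m + 1) =
      payoff c β (θ k) k τ U m + survival (c k) (θ k) τ U m *
        stepValue c β θ μ η A k (fun j => workload (c j) τ U (m + 1)) (τ (m + 1)) (U (m + 1)) := by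
  simp only [valueProcess, payoff, survival, stepValue]
  split_ifs with h
  · ring
  · rw [mul_zero, add_zero, mul_assoc]
    rfl

/-- The variable `Z` is any reward with the stated pathwise form, where jump `N + 1` is the last one
of the first excursion. Constant means along `M` and bounded convergence give its expectation. -/
theorem integral_excursionReward [IsProbabilityMeasure P] {τ U : ℕ → Ω → ℝ} {lam : ℝ}
    (hlam : 0 < lam) {ν : Measure ℝ} [IsProbabilityMeasure ν]
    (hτm : ∀ i, Measurable (τ i)) (hUm : ∀ i, Measurable (U i))
    (hτlaw : ∀ i, P.map (τ i) = expMeasure lam) (hUlaw : ∀ i, P.map (U i) = ν)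
    (hind : iIndepFun (Sum.elim τ U) P)
    (hτpos : ∀ᵐ ω ∂P, ∀ i, 0 < τ i ω) (hUpos : ∀ᵐ ω ∂P, ∀ i, 0 < U i ω)
    {c β θ μ η A φ : ℕ → ℝ} (k : ℕ)
    (hint : ∀ j ≤ k, Integrable (fun u => Real.exp (-η j * u)) ν)
    (hφ : ∀ j ≤ k, ∫ u, Real.exp (-η j * u) ∂ν = φ j)
    (hc : ∀ j ≤ k, 0 < c j) (hanti : ∀ j < k, c (j + 1) ≤ c j)
    (hβ : ∀ j < k, 0 ≤ β j) (hθ0 : 0 ≤ θ k) (hμ0 : ∀ j < k, 0 ≤ μ j) (hη0 : ∀ j ≤ k, 0 ≤ η j)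
    (hη : ∀ j ≤ k, c j * η j = θ j + lam * (1 - φ j))
    (hθ : ∀ j < k, θ j = θ (j + 1) + μ j * (c j - c (j + 1)))
    (hμ : ∀ j < k, μ j * c (j + 1) = lam + θ (j + 1) + β j)
    (hA : ∀ j < k, A j * (β j + lam * φ j) = lam * expMix μ η A φ j 0)
    {Z : Ω → ℝ}
    (hZ : ∀ᵐ ω ∂P, ∃ N,
      (∀ i < N, τ (i + 1) ω ≤ workload (c k) (τ · ω) (U · ω) (i + 1) / c k) ∧
      workload (c k) (τ · ω) (U · ω) (N + 1) / c k < τ (N + 1) ω ∧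
      Z ω = Real.exp (-θ k * (epoch (τ · ω) (N + 1) - epoch (τ · ω) 1 +
          workload (c k) (τ · ω) (U · ω) (N + 1) / c k)) *
        finalReward c β k fun j => workload (c j) (τ · ω) (U · ω) (N + 1)) :
    Integrable Z P ∧ ∫ ω, Z ω ∂P = expMix μ η A φ k 0 := by
  have : IsProbabilityMeasure (expMeasure lam) := isProbabilityMeasure_expMeasure hlam
  obtain ⟨C, hC⟩ := exists_abs_expMix_le μ η A 1 (fun j => by simp) k hμ0 hη0
  set w : ℕ → Ω → ℕ → ℝ := fun m ω j => workload (c j) (τ · ω) (U · ω) m with hw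
  set a : ℕ → Ω → ℝ := fun m ω => survival (c k) (θ k) (τ · ω) (U · ω) m with ha
  set b : ℕ → Ω → ℝ := fun m ω => payoff c β (θ k) k (τ · ω) (U · ω) m with hb
  set M : ℕ → Ω → ℝ := fun m ω => valueProcess c β μ η A (θ k) k (τ · ω) (U · ω) m with hM
  have hwm : ∀ m, Measurable (w m) := fun m => measurable_pi_lambda _ fun j =>
    measurable_workload (c j) m (fun i _ => hτm i) (fun i _ => hUm i)
  have ham : ∀ m, Measurable (a m) := fun m =>
    measurable_survival (c k) (θ k) m (fun i _ => hτm i) (fun i _ => hUm i)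
  have hbm : ∀ m, Measurable (b m) := fun m => measurable_payoff c β (θ k) k m hτm hUm
  have hGm : Measurable fun y => expMix μ η A 1 k y := (continuous_expMix μ η A 1 k).measurable
  have hMm : ∀ m, Measurable (M m) := fun m =>
    (hbm m).add ((ham m).mul (hGm.comp (hwm (m + 1))))
  have hbd : ∀ᵐ ω ∂P, ∀ m, 0 ≤ a m ω ∧ 0 ≤ b m ω ∧ a m ω + b m ω ≤ 1 := by
    filter_upwards [hτpos, hUpos] with ω h1 h2 m
    exact survival_payoff_bounds hθ0 hβ hc hanti h1 h2 m
  have hG : ∀ᵐ ω ∂P, ∀ m, |expMix μ η A 1 k (w m ω)| ≤ C := by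
    filter_upwards [hτpos, hUpos] with ω h1 h2 m
    exact hC _ (fun j _ => workload_nonneg h2 m) fun j hj => workload_anti h1 (hanti j hj) m
  have habs : ∀ {a b G : ℝ}, 0 ≤ a → 0 ≤ b → a + b ≤ 1 → |G| ≤ C → |b + a * G| ≤ 1 + C := by
    intro a b G h1 h2 h3 h4
    have hC0 : 0 ≤ C := (abs_nonneg G).trans h4
    refine (abs_add_le _ _).trans (add_le_add ?_ ?_)
    · rw [abs_of_nonneg h2]; linarith
    · rw [abs_mul, abs_of_nonneg h1]
      nlinarith
  have hMbd : ∀ m, ∀ᵐ ω ∂P, |M m ω| ≤ 1 + C := by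
    intro m
    filter_upwards [hbd, hG] with ω h1 h2
    exact habs (h1 m).1 (h1 m).2.1 (h1 m).2.2 (h2 (m + 1))
  have hbint : ∀ m, Integrable (b m) P := fun m =>
    Integrable.of_bound (hbm m).aestronglyMeasurable 1 <| by
      filter_upwards [hbd] with ω h1
      rw [Real.norm_eq_abs, abs_of_nonneg (h1 m).2.1]
      linarith [(h1 m).1, (h1 m).2.2]
  have hMint : ∀ m, Integrable (M m) P := fun m =>
    Integrable.of_bound (hMm m).aestronglyMeasurable (1 + C) (hMbd m)
  have hstep : ∀ m, ∫ ω, M (m + 1) ω ∂P = ∫ ω, M m ω ∂P := by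
    intro m
    -- Discount and workloads after jump `m + 1` involve only the pairs with index at most `m`, so
    -- the pair with index `m + 1` is independent of them.
    have hS : Measurable[pastSigma τ U (m + 1)] fun ω => (a m ω, w (m + 1) ω) :=
      Measurable.prodMk
        (measurable_survival (c k) (θ k) m (fun i hi => measurable_pastSigma_left τ U hi)
          (fun i hi => measurable_pastSigma_right τ U hi))
        (@measurable_pi_lambda _ _ _ (pastSigma τ U (m + 1)) _ _ fun j =>
          measurable_workload (c j) (m + 1) (fun i hi => measurable_pastSigma_left τ U hi)
          (fun i hi => measurable_pastSigma_right τ U hi))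
    have hτU : IndepFun (τ (m + 1)) (U (m + 1)) P :=
      hind.indepFun (i := Sum.inl (m + 1)) (j := Sum.inr (m + 1)) (by simp)
    have e1 : ∀ ω, M (m + 1) ω = b m ω + a m ω *
        stepValue c β θ μ η A k (w (m + 1) ω) (τ (m + 1) ω) (U (m + 1) ω) := fun ω =>
      valueProcess_succ c β θ μ η A k (τ · ω) (U · ω) m
    -- Written as a difference, this product inherits bound and integrability from `M` and `b`;
    -- hence the constant `1 + C + 1` below.
    have e2 : ∀ ω, a m ω * stepValue c β θ μ η A k (w (m + 1) ω) (τ (m + 1) ω) (U (m + 1) ω) =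
        M (m + 1) ω - b m ω := fun ω => by rw [e1]; ring
    have key : ∫ ω, a m ω *
          stepValue c β θ μ η A k (w (m + 1) ω) (τ (m + 1) ω) (U (m + 1) ω) ∂P =
        ∫ ω, a m ω * expMix μ η A 1 k (w (m + 1) ω) ∂P := by
      refine integral_comp_of_indepFun (S := fun ω => (a m ω, w (m + 1) ω))
        (f := fun s t u => s.1 * stepValue c β θ μ η A k s.2 t u)
        (g := fun s => s.1 * expMix μ η A 1 k s.2) (C := 1 + C + 1)
        ((ham m).prodMk (hwm (m + 1))) (hτm (m + 1)) (hUm (m + 1))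
        (indepFun_of_measurable_pastSigma hτm hUm hind hS) hτU (hτlaw _) (hUlaw _) ?_ ?_ ?_
      · exact measurable_fst.fst.mul ((measurable_stepValue c β θ μ η A k).comp
          (measurable_fst.snd.prodMk measurable_snd))
      · filter_upwards [hbd, hMbd (m + 1)] with ω h1 h2
        simp only [e2]
        refine (abs_sub _ _).trans (add_le_add h2 ?_)
        rw [abs_of_nonneg (h1 m).2.1]
        linarith [(h1 m).1, (h1 m).2.2]
      · filter_upwards [hτpos, hUpos] with ω h1 h2
        simp only [integral_const_mul]
        rw [integral_stepValue hlam k ν hint hφ hc hη hθ hμ hA (w (m + 1) ω)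
          (fun j _ => workload_nonneg h2 _)
          (fun j hj => workload_div_anti (hc (j + 1) (by omega)) h1 h2 (hanti j hj) _)]
    have i1 : Integrable (fun ω => a m ω *
        stepValue c β θ μ η A k (w (m + 1) ω) (τ (m + 1) ω) (U (m + 1) ω)) P := by
      simp only [e2]; exact (hMint (m + 1)).sub (hbint m)
    have i2 : Integrable (fun ω => a m ω * expMix μ η A 1 k (w (m + 1) ω)) P := by
      refine ((hMint m).sub (hbint m)).congr (Eventually.of_forall fun ω => ?_)
      simp [hM, hb, ha, hw, valueProcess]
    have e3 : ∀ ω, M m ω = b m ω + a m ω * expMix μ η A 1 k (w (m + 1) ω) := fun ω => rfl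
    simp only [e1, e3]
    rw [integral_add (hbint m) i1, integral_add (hbint m) i2, key]
  have hconst : ∀ m, ∫ ω, M m ω ∂P = ∫ ω, M 0 ω ∂P := by
    intro m
    induction m with
    | zero => rfl
    | succ m ih => rw [hstep, ih]
  have hM0 : ∫ ω, M 0 ω ∂P = expMix μ η A φ k 0 := by
    -- The queues are empty until the first jump, so all workloads equal `U 0` after it, whatever `τ
    -- 0` is.
    have e : ∀ᵐ ω ∂P, M 0 ω = expMix μ η A 1 k fun j => (0 : ℕ → ℝ) j + U 0 ω := by
      filter_upwards [hτpos] with ω h1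
      simp only [hM, valueProcess, payoff, survival, zero_add, one_mul]
      refine expMix_congr _ _ _ _ _ fun j hj => ?_
      have : 0 ≤ c j * τ 0 ω := mul_nonneg (hc j hj).le (h1 0).le
      simp only [workload, zero_sub, Pi.zero_apply]
      rw [max_eq_right (by linarith)]
    rw [integral_congr_ae e, ← (integral_expMix_add μ η A φ ν k hint hφ 0).2, ← hUlaw 0,
      integral_map (hUm 0).aemeasurable]
    exact ((continuous_expMix μ η A 1 k).comp (by fun_prop)).aestronglyMeasurable
  have hlim : ∀ᵐ ω ∂P, Tendsto (fun m => M m ω) atTop (nhds (Z ω)) := by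
    filter_upwards [hZ] with ω hω
    obtain ⟨N, h1, h2, h3⟩ := hω
    -- Along each path the process is eventually constant: after the excursion the discount is 0 and
    -- the reward has been paid.
    refine tendsto_const_nhds.congr' ?_
    filter_upwards [eventually_gt_atTop N] with m hm
    obtain ⟨h4, h5⟩ := survival_payoff_eq_of_gt (c := c) (β := β) (γ := θ k) (k := k) h1 h2 m hm
    simp only [hM, valueProcess]
    rw [h4, h5, h3]
    ring
  have hZm : AEStronglyMeasurable Z P :=
    aestronglyMeasurable_of_tendsto_ae atTop (fun m => (hMm m).aestronglyMeasurable) hlim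
  have hZbd : ∀ᵐ ω ∂P, ‖Z ω‖ ≤ 1 + C := by
    filter_upwards [hlim, ae_all_iff.2 hMbd] with ω h1 h2
    exact le_of_tendsto h1.norm (Eventually.of_forall h2)
  refine ⟨Integrable.of_bound hZm (1 + C) hZbd, ?_⟩
  have ht := tendsto_integral_of_dominated_convergence (fun _ => 1 + C)
    (fun m => (hMm m).aestronglyMeasurable) (integrable_const _) hMbd hlim
  simp only [hconst, hM0] at ht
  exact tendsto_nhds_unique ht tendsto_const_nhds

end Martingale

/-! ### Almost sure properties of the driving sequences -/

theorem ae_pos_of_map_eq_expMeasure {Ω : Type*} [MeasurableSpace Ω] {P : Measure Ω} {τ : Ω → ℝ}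
    {lam : ℝ} (hlam : 0 < lam) (hτ : AEMeasurable τ P) (h : P.map τ = expMeasure lam) : ∀ᵐ ω ∂P, 0 < τ ω := by
  refine ae_of_ae_map hτ ?_
  have := isProbabilityMeasure_expMeasure hlam
  rw [h, ae_iff]
  have h0 := cdf_expMeasure_eq hlam 0
  rw [cdf_eq_real] at h0
  simp only [le_refl, mul_zero, neg_zero, Real.exp_zero, sub_self, ite_true] at h0
  simp only [not_lt]
  exact (measureReal_eq_zero_iff).1 h0

section Noise

variable {Ω : Type*} [MeasurableSpace Ω] {P : Measure Ω} [IsProbabilityMeasure P]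

/-- Sums of positive i.i.d. random variables tend to infinity. -/
theorem ae_tendsto_epoch_atTop {τ : ℕ → Ω → ℝ} (hτ : ∀ i, AEMeasurable (τ i) P)
    (hind : Pairwise fun i j => IndepFun (τ i) (τ j) P)
    (hident : ∀ i, IdentDistrib (τ i) (τ 0) P P) (hpos : ∀ᵐ ω ∂P, ∀ i, 0 < τ i ω) :
    ∀ᵐ ω ∂P, Tendsto (epoch (τ · ω)) atTop atTop := by
  -- Truncation at 1 keeps the mean positive and makes the strong law applicable without an
  -- integrability assumption.
  have hg : Measurable fun x : ℝ => min x 1 := by fun_prop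
  have hint : Integrable (fun ω => min (τ 0 ω) 1) P :=
    Integrable.of_bound (hg.comp_aemeasurable (hτ 0)).aestronglyMeasurable 1 <| by
      filter_upwards [hpos] with ω h
      rw [Real.norm_eq_abs, abs_of_pos (lt_min (h 0) one_pos)]
      exact min_le_right _ _
  have hmean : 0 < ∫ ω, min (τ 0 ω) 1 ∂P := by
    rw [integral_pos_iff_support_of_nonneg_ae]
    · have : P (Function.support fun ω => min (τ 0 ω) 1) = P Set.univ := by
        refine measure_congr ?_
        filter_upwards [hpos] with ω h
        exact propext ⟨fun _ => trivial, fun _ => (lt_min (h 0) one_pos).ne'⟩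
      rw [this]
      simp
    · filter_upwards [hpos] with ω h using (lt_min (h 0) one_pos).le
    · exact hint
  have h := strong_law_ae_real (fun i ω => min (τ i ω) 1) hint
    (fun i j hij => (hind hij).comp hg hg) (fun i => (hident i).comp hg)
  filter_upwards [h] with ω h1
  have h2 := h1.pos_mul_atTop hmean tendsto_natCast_atTop_atTop
  refine tendsto_atTop_mono (fun m => ?_) h2
  rcases Nat.eq_zero_or_pos m with rfl | hm
  · simp [epoch]
  · rw [div_mul_cancel₀ _ (by positivity)]
    exact Finset.sum_le_sum fun i _ => min_le_left _ _

/-- The interarrival times and jump sizes can be taken measurable. -/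
theorem LevyExcursion.IsPosCompoundPoisson.exists_measurable_repr {lam : ℝ} {Pi : ℝ → Ω → ℝ}
    (h : IsPosCompoundPoisson P lam Pi) :
    ∃ τ U : ℕ → Ω → ℝ, (∀ i, Measurable (τ i)) ∧ (∀ i, Measurable (U i)) ∧
      (∀ i, P.map (τ i) = expMeasure lam) ∧ (∀ i, P.map (U i) = P.map (U 0)) ∧
      iIndepFun (Sum.elim τ U) P ∧
      (∀ᵐ ω ∂P, ∀ i, 0 < τ i ω) ∧ (∀ᵐ ω ∂P, ∀ i, 0 < U i ω) ∧
      (∀ᵐ ω ∂P, Tendsto (epoch (τ · ω)) atTop atTop) ∧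
      ∀ᵐ ω ∂P, ∀ m t, epoch (τ · ω) m ≤ t → t < epoch (τ · ω) (m + 1) →
        Pi t ω = ∑ i ∈ Finset.range m, U i ω := by
  obtain ⟨τ, U, hτ, hU, hpos, hind, hrepr⟩ := h.exists_repr
  have mτ := fun i => (hτ i).aemeasurable
  have mU := fun i => (hU i).aemeasurable_fst
  have eτ : ∀ᵐ ω ∂P, ∀ i, τ i ω = (mτ i).mk (τ i) ω := ae_all_iff.2 fun i => (mτ i).ae_eq_mk
  have eU : ∀ᵐ ω ∂P, ∀ i, U i ω = (mU i).mk (U i) ω := ae_all_iff.2 fun i => (mU i).ae_eq_mk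
  have lawτ : ∀ i, P.map ((mτ i).mk (τ i)) = expMeasure lam := fun i => by
    rw [← Measure.map_congr (mτ i).ae_eq_mk, (hτ i).map_eq]
  have hτpos : ∀ᵐ ω ∂P, ∀ i, 0 < (mτ i).mk (τ i) ω := ae_all_iff.2 fun i =>
    ae_pos_of_map_eq_expMeasure h.rate_pos (mτ i).measurable_mk.aemeasurable (lawτ i)
  have hind' : iIndepFun (Sum.elim (fun i => (mτ i).mk (τ i)) fun i => (mU i).mk (U i)) P := by
    refine iIndepFun.congr ?_ hind
    rintro (i | i)
    exacts [(mτ i).ae_eq_mk, (mU i).ae_eq_mk]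
  refine ⟨fun i => (mτ i).mk (τ i), fun i => (mU i).mk (U i), fun i => (mτ i).measurable_mk,
    fun i => (mU i).measurable_mk, lawτ, fun i => ?_, hind', hτpos, ?_, ?_, ?_⟩
  · rw [← Measure.map_congr (mU i).ae_eq_mk, ← Measure.map_congr (mU 0).ae_eq_mk, (hU i).map_eq]
  · filter_upwards [ae_all_iff.2 hpos, eU] with ω h1 h2 i
    rw [← h2]; exact h1 i
  · refine ae_tendsto_epoch_atTop (fun i => (mτ i).measurable_mk.aemeasurable) (fun i j hij => ?_)
      (fun i => ⟨(mτ i).measurable_mk.aemeasurable, (mτ 0).measurable_mk.aemeasurable,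
        by rw [lawτ, lawτ]⟩) hτpos
    exact hind'.indepFun (i := Sum.inl i) (j := Sum.inl j) (by simpa using hij)
  · filter_upwards [hrepr, eτ, eU] with ω h1 h2 h3 m t
    simp only [epoch, ← h2, ← h3]
    exact h1 m t

end Noise

/-! ### Identification of `rho` and `sigma`, and the parameters of the value function -/

/-- Pathwise description of the functionals of the first excursion: `N + 2` is the index of the
first jump after its end. -/
theorem exists_rho_sigma_eq {Ω : Type*} {X : ℕ → ℝ → Ω → ℝ} {ω : Ω} {c τ U : ℕ → ℝ} {n k : ℕ}
    (hanti : StrictAntiOn c (Set.Icc 1 n)) (hτ : ∀ i, 0 < τ i) (hU : ∀ i, 0 < U i)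
    (hlim : Tendsto (epoch τ) atTop atTop)
    (hx : ∀ j ∈ Set.Icc 1 n, ∀ m t, epoch τ m ≤ t → t < epoch τ (m + 1) →
      X j t ω = ∑ i ∈ Finset.range m, U i - c j * t)
    (hdrift : ∀ j ∈ Set.Icc 1 n, Tendsto (fun t => X j t ω) atTop atBot)
    (hk : k ∈ Set.Icc 1 n) :
    ∃ N, (∀ i < N, τ (i + 1) ≤ workload (c k) τ U (i + 1) / c k) ∧
      workload (c k) τ U (N + 1) / c k < τ (N + 1) ∧
      (∀ j ∈ Set.Icc 1 k, rho X k j ω = emptyingTime (c j) τ U (N + 1)) ∧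
      sigma X k k ω = epoch τ 1 := by
  have hc : 0 < c k := rate_pos_of_tendsto_atBot hU (hx k hk) hlim (hdrift k hk)
  have hinf := infinite_workload_lt hτ (hx k hk) hU hlim (hdrift k hk)
  have h0 : Nat.nth (fun m => workload (c k) τ U m < c k * τ m) 0 = 0 :=
    Nat.nth_zero_of_zero (by simpa [workload] using mul_pos hc (hτ 0))
  have hlt := Nat.nth_strictMono hinf zero_lt_one
  obtain ⟨N, hN⟩ := Nat.exists_eq_succ_of_ne_zero ((Nat.zero_le _).trans_lt hlt).ne'
  refine ⟨N, fun i hi => ?_, ?_, fun j hj => ?_, ?_⟩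
  · by_contra! h
    rw [div_lt_iff₀' hc] at h
    obtain ⟨a, ha⟩ : i + 1 ∈ Set.range (Nat.nth fun m => workload (c k) τ U m < c k * τ m) := by
      rw [Nat.range_nth_of_infinite hinf]; exact h
    have h1 : Nat.nth (fun m => workload (c k) τ U m < c k * τ m) a <
      Nat.nth (fun m => workload (c k) τ U m < c k * τ m) 1 := by rw [ha, hN]; omega
    have h2 := (Nat.nth_strictMono hinf).lt_iff_lt.1 h1
    -- The only emptying index before the first positive one is 0, which is not of the form `i + 1`.
    obtain rfl : a = 0 := by omega
    omega
  · have := Nat.nth_mem_of_infinite hinf 1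
    rw [hN] at this
    rwa [div_lt_iff₀' hc]
  · have hjn : j ∈ Set.Icc 1 n := ⟨hj.1, hj.2.trans hk.2⟩
    rw [← Nat.succ_eq_add_one, ← hN]
    exact sSup_excEnd_eq hc (hanti.antitoneOn hjn hk hj.2) hτ hU hlim (hx k hk) (hx j hjn)
      (hdrift k hk) (hdrift j hjn)
  · exact sSup_excStart_eq hc hτ hU hlim (hx k hk) (hdrift k hk)

/-- The equation for the inverse of the Laplace exponent is solvable. -/
theorem exists_laplaceExponent_inverse {ν : Measure ℝ} [IsProbabilityMeasure ν]
    (hν : ∀ᵐ u ∂ν, 0 < u) {c lam θ : ℝ} (hc : 0 < c) (hlam : 0 < lam) (hθ : 0 ≤ θ) :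
    ∃ η, 0 ≤ η ∧ c * η = θ + lam * (1 - ∫ u, Real.exp (-η * u) ∂ν) := by
  -- At `b` the left side already equals `θ + lam`, the largest possible right side, so the
  -- intermediate value theorem applies on `[0, b]`. Any root will do; uniqueness plays no role.
  set b := (θ + lam) / c with hb
  have hb0 : 0 ≤ b := by positivity
  have hL : ContinuousOn (fun η : ℝ => ∫ u, Real.exp (-η * u) ∂ν) (Set.Icc 0 b) := by
    refine continuousOn_of_dominated (bound := fun _ => 1) (fun η _ => ?_) (fun η hη => ?_)
      (integrable_const _) (Eventually.of_forall fun u => by fun_prop)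
    · exact Continuous.aestronglyMeasurable (by fun_prop)
    · filter_upwards [hν] with u hu
      rw [Real.norm_eq_abs, Real.abs_exp, Real.exp_le_one_iff]
      nlinarith [mul_nonneg hη.1 hu.le]
  have hf : ContinuousOn (fun η : ℝ => c * η - (θ + lam * (1 - ∫ u, Real.exp (-η * u) ∂ν)))
      (Set.Icc 0 b) := by fun_prop
  have h0 : (0 : ℝ) ∈ Set.Icc
      (c * 0 - (θ + lam * (1 - ∫ u, Real.exp (-(0 : ℝ) * u) ∂ν)))
      (c * b - (θ + lam * (1 - ∫ u, Real.exp (-b * u) ∂ν))) := by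
    constructor
    · simp [hθ]
    · have : c * b = θ + lam := by rw [hb]; field_simp
      have hpos : 0 ≤ ∫ u, Real.exp (-b * u) ∂ν := integral_nonneg fun u => (Real.exp_nonneg _)
      rw [this]
      nlinarith [mul_nonneg hlam.le hpos]
  obtain ⟨η, hη, he⟩ := intermediate_value_Icc hb0 hf h0
  exact ⟨η, hη.1, sub_eq_zero.1 he⟩

/-- At 0 all exponentials are 1, and adding queue `k + 1` adds `A k * (φ (k + 1) - φ k)`, which
amounts to one more factor. The explicit form of `A` avoids a definition in terms of `expMix`
itself. -/
theorem expMix_zero_eq_prod {lam : ℝ} {β μ η A φ : ℕ → ℝ} (k : ℕ)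
    (hpos : ∀ j < k, β j + lam * φ j ≠ 0)
    (hA : ∀ j < k, A j = lam * (φ 0 * ∏ i ∈ Finset.range j,
      (β i + lam * φ (i + 1)) / (β i + lam * φ i)) / (β j + lam * φ j)) :
    expMix μ η A φ k 0 =
      φ 0 * ∏ i ∈ Finset.range k, (β i + lam * φ (i + 1)) / (β i + lam * φ i) := by
  induction k with
  | zero => simp [expMix]
  | succ k ih =>
    rw [expMix, ih (fun j hj => hpos j (by omega)) (fun j hj => hA j (by omega)),
      Finset.prod_range_succ, hA k (by omega)]
    have := hpos k (by omega)
    simp only [Pi.zero_apply, sub_zero, mul_zero, Real.exp_zero, mul_one, one_mul]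
    field_simp
    ring

theorem shiftC_self (c : ℕ → ℝ) (lam : ℝ) (β : ℕ → ℝ) (k : ℕ) : shiftC c lam β k k = 0 := by
  simp [shiftC]

/-- With the term `c j / c k * γ` added, this is the recursion for the discounts `θ` that the
coupling of neighbouring queues demands. -/
theorem shiftC_eq_succ {c : ℕ → ℝ} {lam : ℝ} {β : ℕ → ℝ} {k j : ℕ} (hj : j < k)
    (h0 : c j ≠ 0) (h1 : c (j + 1) ≠ 0) :
    shiftC c lam β k j = c j / c (j + 1) * shiftC c lam β k (j + 1) +
      (c j / c (j + 1) - 1) * (lam + β j) := by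
  rw [shiftC, shiftC, Finset.sum_eq_sum_Ico_succ_bot hj]
  field_simp
  ring

theorem shiftC_nonneg {c : ℕ → ℝ} {lam : ℝ} {β : ℕ → ℝ} {k j n : ℕ} (hlam : 0 < lam)
    (hanti : StrictAntiOn c (Set.Icc 1 n)) (hc : ∀ j ∈ Set.Icc 1 n, 0 < c j)
    (hβ : ∀ j ∈ Finset.Ico 1 k, 0 ≤ β j) (hkn : k ≤ n) (hj : 1 ≤ j) (hjk : j ≤ k) :
    0 ≤ shiftC c lam β k j := by
  refine mul_nonneg (hc j ⟨hj, hjk.trans hkn⟩).le (Finset.sum_nonneg fun l hl => ?_)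
  rw [Finset.mem_Ico] at hl
  have m0 : l ∈ Set.Icc 1 n := ⟨by omega, by omega⟩
  have m1 : l + 1 ∈ Set.Icc 1 n := ⟨by omega, by omega⟩
  have h1 := one_div_le_one_div_of_le (hc _ m1) (hanti m0 m1 l.lt_succ_self).le
  have h2 := hβ l (Finset.mem_Ico.2 ⟨by omega, hl.2⟩)
  exact mul_nonneg (by linarith) (by linarith)

/-! ### The product formula -/

/-- The quasi-product formula for measurable interarrival times and jump sizes, for the queues with
rates `c s, …, c (s + K)`. -/
theorem integral_exp_rho_sigma {Ω : Type*} [MeasurableSpace Ω] {P : Measure Ω}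
    [IsProbabilityMeasure P] {n : ℕ} {lam : ℝ} {c : ℕ → ℝ} {X : ℕ → ℝ → Ω → ℝ}
    {τ U : ℕ → Ω → ℝ} (hlam : 0 < lam)
    (hτm : ∀ i, Measurable (τ i)) (hUm : ∀ i, Measurable (U i))
    (hτlaw : ∀ i, P.map (τ i) = expMeasure lam) (hUlaw : ∀ i, P.map (U i) = P.map (U 0))
    (hind : iIndepFun (Sum.elim τ U) P)
    (hτpos : ∀ᵐ ω ∂P, ∀ i, 0 < τ i ω) (hUpos : ∀ᵐ ω ∂P, ∀ i, 0 < U i ω)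
    (hlim : ∀ᵐ ω ∂P, Tendsto (epoch (τ · ω)) atTop atTop)
    (hanti : StrictAntiOn c (Set.Icc 1 n)) (hc : ∀ j ∈ Set.Icc 1 n, 0 < c j)
    (hx : ∀ᵐ ω ∂P, ∀ j ∈ Set.Icc 1 n, ∀ m t, epoch (τ · ω) m ≤ t → t < epoch (τ · ω) (m + 1) →
      X j t ω = ∑ i ∈ Finset.range m, U i ω - c j * t)
    (hdrift : ∀ᵐ ω ∂P, ∀ j ∈ Set.Icc 1 n, Tendsto (fun t => X j t ω) atTop atBot)
    {s K : ℕ} (hs : 1 ≤ s) (hK : s + K ≤ n) {β θ η φ : ℕ → ℝ}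
    (hβ : ∀ j < K, 0 ≤ β j) (hθ0 : ∀ j ≤ K, 0 ≤ θ j) (hη0 : ∀ j ≤ K, 0 ≤ η j)
    (hφ : ∀ j ≤ K, ∫ u, Real.exp (-η j * u) ∂(P.map (U 0)) = φ j)
    (hη : ∀ j ≤ K, c (s + j) * η j = θ j + lam * (1 - φ j))
    (hθ : ∀ j < K, θ j = c (s + j) / c (s + (j + 1)) * θ (j + 1) +
      (c (s + j) / c (s + (j + 1)) - 1) * (lam + β j)) :
    Integrable (fun ω => Real.exp
      (-(∑ j ∈ Finset.range K, β j * (rho X (s + K) (s + (j + 1)) ω - rho X (s + K) (s + j) ω))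
        - θ K * (rho X (s + K) (s + K) ω - sigma X (s + K) (s + K) ω))) P ∧
    ∫ ω, Real.exp
      (-(∑ j ∈ Finset.range K, β j * (rho X (s + K) (s + (j + 1)) ω - rho X (s + K) (s + j) ω))
        - θ K * (rho X (s + K) (s + K) ω - sigma X (s + K) (s + K) ω)) ∂P =
      φ 0 * ∏ i ∈ Finset.range K, (β i + lam * φ (i + 1)) / (β i + lam * φ i) := by
  have hmem : ∀ j ≤ K, s + j ∈ Set.Icc 1 n := fun j hj => ⟨by omega, by omega⟩
  have : IsProbabilityMeasure (P.map (U 0)) :=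
    Measure.isProbabilityMeasure_map (hUm 0).aemeasurable
  have hν : ∀ᵐ u ∂(P.map (U 0)), 0 < u :=
    (ae_map_iff (hUm 0).aemeasurable measurableSet_Ioi).2 (hUpos.mono fun ω h => h 0)
  have hint : ∀ j ≤ K, Integrable (fun u => Real.exp (-η j * u)) (P.map (U 0)) := fun j hj =>
    Integrable.of_bound (Continuous.aestronglyMeasurable (by fun_prop)) 1 <| by
      filter_upwards [hν] with u hu
      rw [Real.norm_eq_abs, Real.abs_exp, Real.exp_le_one_iff]
      nlinarith [mul_nonneg (hη0 j hj) hu.le]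
  have hφ0 : ∀ j ≤ K, 0 < φ j := fun j hj => by
    rw [← hφ j hj]; exact integral_exp_pos (hint j hj)
  have hden : ∀ j < K, 0 < β j + lam * φ j := fun j hj =>
    add_pos_of_nonneg_of_pos (hβ j hj) (mul_pos hlam (hφ0 j hj.le))
  set A : ℕ → ℝ := fun j => lam * (φ 0 * ∏ i ∈ Finset.range j,
      (β i + lam * φ (i + 1)) / (β i + lam * φ i)) / (β j + lam * φ j) with hA
  -- The one choice allowed by the equation for the phase in which only the slower queue is busy;
  -- the recursion for `θ` then gives the other coupling equation.
  set μ : ℕ → ℝ := fun j => (lam + θ (j + 1) + β j) / c (s + (j + 1)) with hμ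
  have hprod : ∀ k ≤ K, expMix μ η A φ k 0 =
      φ 0 * ∏ i ∈ Finset.range k, (β i + lam * φ (i + 1)) / (β i + lam * φ i) := fun k hk =>
    expMix_zero_eq_prod k (fun j hj => (hden j (by omega)).ne') fun j _ => rfl
  rw [← hprod K le_rfl]
  refine integral_excursionReward (c := fun j => c (s + j)) (β := β) hlam hτm hUm hτlaw hUlaw hind
    hτpos hUpos K hint hφ (fun j hj => hc _ (hmem j hj)) (fun j hj => ?_) hβ (hθ0 K le_rfl)
    (fun j hj => ?_) hη0 hη (fun j hj => ?_) (fun j hj => ?_) (fun j hj => ?_) ?_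
  · exact (hanti (hmem j hj.le) (hmem (j + 1) hj) (by omega)).le
  · have h1 := hβ j hj
    have h2 := hθ0 (j + 1) hj
    have h3 := hc _ (hmem (j + 1) hj)
    simp only [hμ]
    positivity
  · have h3 := (hc _ (hmem (j + 1) hj)).ne'
    rw [hθ j hj]
    simp only [hμ]
    field_simp
    ring
  · simp only [hμ]
    exact div_mul_cancel₀ _ (hc _ (hmem (j + 1) hj)).ne'
  · rw [hprod j hj.le]
    simp only [hA]
    exact div_mul_cancel₀ _ (hden j hj).ne'
  · filter_upwards [hτpos, hUpos, hlim, hx, hdrift] with ω h1 h2 h3 h4 h5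
    obtain ⟨N, g1, g2, g3, g4⟩ := exists_rho_sigma_eq hanti h1 h2 h3 h4 h5 (hmem K le_rfl)
    refine ⟨N, g1, g2, ?_⟩
    have g5 : ∀ j ≤ K, rho X (s + K) (s + j) ω =
        emptyingTime (c (s + j)) (τ · ω) (U · ω) (N + 1) := fun j hj =>
      g3 _ ⟨by omega, by omega⟩
    rw [g4, g5 K le_rfl, finalReward, ← Real.exp_add]
    congr 1
    rw [Finset.sum_congr rfl fun j hj => by
      rw [g5 (j + 1) (Finset.mem_range.1 hj), g5 j (Finset.mem_range.1 hj).le]]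
    simp only [emptyingTime, add_sub_add_left_eq_sub]
    ring

theorem proposition4p2 {Ω : Type*} [MeasurableSpace Ω] (P : Measure Ω) [IsProbabilityMeasure P]
    (n : ℕ) (lam : ℝ) (c : ℕ → ℝ) (X : ℕ → ℝ → Ω → ℝ)
    (hD : AssumptionD P n X) (hH : AssumptionH P n lam c X)
    (k : ℕ) (hk : 2 ≤ k) (hkn : k ≤ n)
    (β : ℕ → ℝ) (hβ : ∀ j ∈ Finset.Ico 1 k, 0 ≤ β j) (γ : ℝ) (hγ : 0 ≤ γ) :
    -- the random variables whose expectations appear below are integrable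
    Integrable (fun ω => Real.exp
      (-(∑ j ∈ Finset.Ico 1 k, β j * (rho X k (j + 1) ω - rho X k j ω))
        - γ * (rho X k k ω - sigma X k k ω))) P ∧
    (∀ j ∈ Finset.Icc 1 k, Integrable (fun ω => Real.exp
      (-(shiftC c lam β k j + c j / c k * γ) * (rho X j j ω - sigma X j j ω))) P) ∧
    -- the quasi-product formula
    ∫ ω, Real.exp
      (-(∑ j ∈ Finset.Ico 1 k, β j * (rho X k (j + 1) ω - rho X k j ω))
        - γ * (rho X k k ω - sigma X k k ω)) ∂P
      = (∏ j ∈ Finset.Ico 1 k,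
          (β j + lam * excTransform P X (j + 1) (shiftC c lam β k (j + 1) + c (j + 1) / c k * γ)) /
          (β j + lam * excTransform P X j (shiftC c lam β k j + c j / c k * γ)))
        * excTransform P X 1 (shiftC c lam β k 1 + c 1 / c k * γ) := by
  obtain ⟨hanti, Pi, hPi, hX⟩ := hH
  have hlam := hPi.rate_pos
  obtain ⟨τ, U, hτm, hUm, hτlaw, hUlaw, hind, hτpos, hUpos, hlim, hrepr⟩ :=
    hPi.exists_measurable_repr
  have hdrift : ∀ᵐ ω ∂P, ∀ j ∈ Set.Icc 1 n, Tendsto (fun t => X j t ω) atTop atBot :=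
    (ae_ball_iff (Set.to_countable _)).2 hD
  have hX' : ∀ᵐ ω ∂P, ∀ j ∈ Set.Icc 1 n, ∀ t : ℝ, 0 ≤ t → X j t ω = Pi t ω - c j * t :=
    (ae_ball_iff (Set.to_countable _)).2 hX
  have hx : ∀ᵐ ω ∂P, ∀ j ∈ Set.Icc 1 n, ∀ m t, epoch (τ · ω) m ≤ t →
      t < epoch (τ · ω) (m + 1) → X j t ω = ∑ i ∈ Finset.range m, U i ω - c j * t := by
    filter_upwards [hX', hrepr, hτpos] with ω h1 h2 h3 j hj m t ht1 ht2
    rw [h1 j hj t ((epoch_nonneg h3 m).trans ht1), h2 m t ht1 ht2]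
  have hc : ∀ j ∈ Set.Icc 1 n, 0 < c j := by
    obtain ⟨ω, h1, h2, h3, h4⟩ := (hUpos.and (hx.and (hlim.and hdrift))).exists
    exact fun j hj => rate_pos_of_tendsto_atBot h1 (h2 j hj) h3 (h4 j hj)
  have : IsProbabilityMeasure (P.map (U 0)) :=
    Measure.isProbabilityMeasure_map (hUm 0).aemeasurable
  have hν : ∀ᵐ u ∂(P.map (U 0)), 0 < u :=
    (ae_map_iff (hUm 0).aemeasurable measurableSet_Ioi).2 (hUpos.mono fun ω h => h 0)
  have hck := hc k ⟨by omega, hkn⟩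
  set θ : ℕ → ℝ := fun j => shiftC c lam β k j + c j / c k * γ with hθdef
  have hθ0 : ∀ j ∈ Set.Icc 1 k, 0 ≤ θ j := fun j hj => by
    have h1 := shiftC_nonneg (β := β) hlam hanti hc hβ hkn hj.1 hj.2
    have h2 := hc j ⟨hj.1, hj.2.trans hkn⟩
    simp only [hθdef]
    positivity
  have hex : ∀ j, ∃ η, j ∈ Set.Icc 1 k →
      0 ≤ η ∧ c j * η = θ j + lam * (1 - ∫ u, Real.exp (-η * u) ∂(P.map (U 0))) := fun j => by
    by_cases hj : j ∈ Set.Icc 1 k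
    · obtain ⟨η, h⟩ := exists_laplaceExponent_inverse hν (hc j ⟨hj.1, hj.2.trans hkn⟩) hlam
        (hθ0 j hj)
      exact ⟨η, fun _ => h⟩
    · exact ⟨0, fun h => absurd h hj⟩
  choose η hη using hex
  set φ : ℕ → ℝ := fun j => ∫ u, Real.exp (-η j * u) ∂(P.map (U 0)) with hφ
  -- With `K = 0` no rewards or couplings remain, and the formula reduces to the transform of one
  -- excursion.
  have hsingle : ∀ j ∈ Set.Icc 1 k,
      Integrable (fun ω => Real.exp (-θ j * (rho X j j ω - sigma X j j ω))) P ∧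
        excTransform P X j (θ j) = φ j := by
    intro j hj
    have h := integral_exp_rho_sigma hlam hτm hUm hτlaw hUlaw hind hτpos hUpos hlim hanti hc hx
      hdrift (s := j) (K := 0) hj.1 (hj.2.trans hkn) (β := 0) (θ := fun _ => θ j)
      (η := fun _ => η j) (φ := fun _ => φ j) (by simp) (fun _ _ => hθ0 j hj)
      (fun _ _ => (hη j hj).1) (fun _ _ => rfl)
      (fun i hi => by obtain rfl : i = 0 := by omega
                      exact (hη j hj).2) (by simp)
    simp only [Finset.range_zero, Finset.sum_empty, Finset.prod_empty, mul_one, neg_zero, zero_sub,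
      add_zero, ← neg_mul] at h
    exact h
  obtain ⟨K, rfl⟩ : ∃ K, k = 1 + K := ⟨k - 1, by omega⟩
  have hmem : ∀ j ≤ K, 1 + j ∈ Set.Icc 1 (1 + K) := fun j hj => ⟨by omega, by omega⟩
  -- The slowest queue carries the discount `γ` of the theorem, because `𝒞_k^k(β) = 0`.
  have hθK : θ (1 + K) = γ := by
    simp only [hθdef, shiftC_self, div_self hck.ne', zero_add, one_mul]
  have hmain := integral_exp_rho_sigma hlam hτm hUm hτlaw hUlaw hind hτpos hUpos hlim hanti hc hx
      hdrift (s := 1) (K := K) le_rfl hkn (β := fun j => β (1 + j)) (θ := fun j => θ (1 + j))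
      (η := fun j => η (1 + j)) (φ := fun j => φ (1 + j))
      (fun j hj => hβ _ (Finset.mem_Ico.2 ⟨by omega, by omega⟩))
      (fun j hj => hθ0 _ (hmem j hj)) (fun j hj => (hη _ (hmem j hj)).1) (fun _ _ => rfl)
      (fun j hj => (hη _ (hmem j hj)).2) (fun j hj => by
        have h0 := (hc (1 + j) ⟨by omega, by omega⟩).ne'
        have h1 := (hc (1 + j + 1) ⟨by omega, by omega⟩).ne'
        simp only [hθdef, ← add_assoc]
        rw [shiftC_eq_succ (by omega) h0 h1]
        field_simp
        ring)
  simp only [hθK] at hmain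
  have hsum : ∀ f : ℕ → ℝ, ∑ j ∈ Finset.Ico 1 (1 + K), f j = ∑ j ∈ Finset.range K, f (1 + j) :=
    fun f => by rw [Finset.sum_Ico_eq_sum_range, Nat.add_sub_cancel_left]
  refine ⟨?_, fun j hj => (hsingle j (by simpa using hj)).1, ?_⟩
  · simp only [hsum]
    exact hmain.1
  · simp only [hsum]
    refine hmain.2.trans ?_
    have e1 : excTransform P X 1 (θ 1) = φ 1 := (hsingle 1 (hmem 0 (by omega))).2
    rw [e1, mul_comm, Finset.prod_Ico_eq_prod_range, Nat.add_sub_cancel_left]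
    congr 1
    refine Finset.prod_congr rfl fun j hj => ?_
    rw [Finset.mem_range] at hj
    have e2 := (hsingle (1 + j) (hmem j hj.le)).2
    have e3 := (hsingle (1 + j + 1) (hmem (j + 1) hj)).2
    rw [e2, e3]
    rfl
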